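/- Let $k$ be a field and let $G$ be a locally profinite group, that is, a (Hausdorff) locally compact totally disconnected topological group. A $G$-module over $k$ is *smooth* if the stabilizer of every vector is open in $G$; $G\text{-smooth}_k$ is the category of smooth $G$-modules, with $G$-equivariant $k$-linear maps. For a topological space $X$ and a $k$-vector space $V$, let $V[[X]]$ be the $k$-vector space of compactly supported finitely additive $V$-valued measures on the open-closed subsets of $X$. A *$G$-contramodule* over $k$ is a $k$-vector space $P$ with a $k$-linear map $\pi\colon P[[G]]\to P$ such that the two maps $P[[G\times G]]\rightrightarrows P[[G]]$, namely the pushforward along the multiplication of $G$ and the composition of the natural injection $P[[G\times G]]\to P[[G]][[G]]$, $\mu\mapsto(B\mapsto(A\mapsto\mu(A\times B)))$, with the map $P[[G]][[G]]\to P[[G]]$ induced by $\pi$, have equal compositions with $\pi$, and such that $\pi$ takes the point measure at the unit element with value $x$ to $x$, for every $x\in P$. $G\text{-contra}_k$ is the category of $G$-contramodules, with the $k$-linear maps commuting with the contraactions. Let $S=k(G)$ be the space of compactly supported locally constant functions $G\to k$, with the left $G$-module structure $(gf)(x)=f(g^{-1}x)$, and put $T=\operatorname{End}_{k[G]}(S)^{\mathrm{op}}$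 (the product in $\operatorname{End}$ being the composition of maps). Denote by $S'$ the same space $k(G)$ with the smooth $G$-module structure $(gf)(x)=f(xg)$. Then: (a) There is an isomorphism of $k$-algebras $\alpha$ from the algebra of endomorphisms of the forgetful functor $G\text{-smooth}_k\to k\text{-mod}$ onto $T^{\mathrm{op}}=\operatorname{End}_{k[G]}(S)$. It is natural in the following sense: for every endomorphism $\eta$ of the forgetful functor, $\alpha(\eta)$ is the operator $\eta_{S'}$ by which $\eta$ acts in $S'$. (b) There is an isomorphism of $k$-algebras $\beta$ from the algebra of endomorphisms of the forgetful functor $G\text{-contra}_k\to k\text{-mod}$ onto $T$. It is natural in the following sense: let $N$ be a smooth $G$-module and $V$ a $k$-vector space, and let $\operatorname{Hom}_k(N,V)$ be the $G$-contramodule with the contraaction $\pi(\mu)(n)=\int_G d\mu_g(gn)$. Then, for every $t\in T$, the endomorphism $\beta^{-1}(t)$ acts in $\operatorname{Hom}_k(N,V)$ by $\xi\mapsto\xi\circ\alpha^{-1}(t)_N$, where $t$ is viewed as an element of $T^{\mathrm{op}}$ on the right-hand side. -/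

import Mathlib

open CategoryTheory TopologicalSpace Topology

universe u v w

noncomputable section

namespace SmoothContra

/-! ### Smooth representations -/

section Smooth

variable (k : Type u) (G : Type v) [Field k] [Group G] [TopologicalSpace G]

/-- A `G`-module over `k` is smooth if the stabilizer of every vector is open in `G`. -/
def IsSmooth : ObjectProperty (Rep.{w} k G) :=
  fun M => ∀ x : M.V, IsOpen {g : G | M.ρ g x = x}

/-- The category of smooth `G`-modules over `k`, a full subcategory of all `G`-modules. -/
abbrev SmoothRep := (IsSmooth.{u, v, w} k G).FullSubcategory

/-- The forgetful functor from smooth `G`-modules to `k`-vector spaces. -/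
abbrev smoothForget : SmoothRep.{u, v, w} k G ⥤ ModuleCat.{w} k :=
  (IsSmooth.{u, v, w} k G).ι ⋙ forget₂ (Rep.{w} k G) (ModuleCat.{w} k)

/-- The space of compactly supported locally constant functions `G → k`. -/
def testFunctions : Submodule k (G → k) where
  carrier := {f | IsLocallyConstant f ∧ HasCompactSupport f}
  add_mem' := fun ha hb => ⟨ha.1.add hb.1, ha.2.add hb.2⟩
  zero_mem' := ⟨IsLocallyConstant.const 0, HasCompactSupport.zero⟩
  smul_mem' := fun c _ hf => ⟨hf.1.comp (fun y => c * y), hf.2.smul_left (f := fun _ : G => c)⟩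

variable [IsTopologicalGroup G]

/-- Left translations `(g f)(x) = f (g⁻¹ x)` on compactly supported locally constant functions. -/
def leftTranslation : Representation k G (testFunctions k G) where
  toFun g :=
    { toFun := fun f => ⟨fun x => f.1 (g⁻¹ * x),
        f.2.1.comp_continuous (continuous_const_mul g⁻¹),
        f.2.2.comp_homeomorph (Homeomorph.mulLeft g⁻¹)⟩
      map_add' := fun _ _ => rfl
      map_smul' := fun _ _ => rfl }
  map_one' := by
    ext f x
    simp
  map_mul' g h := by
    ext f x
    simp [mul_assoc]

/-- Right translations `(g f)(x) = f (x g)` on compactly supported locally constant functions. -/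
def rightTranslation : Representation k G (testFunctions k G) where
  toFun g :=
    { toFun := fun f => ⟨fun x => f.1 (x * g),
        f.2.1.comp_continuous (continuous_mul_const g),
        f.2.2.comp_homeomorph (Homeomorph.mulRight g)⟩
      map_add' := fun _ _ => rfl
      map_smul' := fun _ _ => rfl }
  map_one' := by
    ext f x
    simp
  map_mul' g h := by
    ext f x
    simp [mul_assoc]

theorem eventually_leftTranslate_eq {f : G → k} (hf : IsLocallyConstant f)
    (hc : HasCompactSupport f) : ∀ᶠ u in 𝓝 (1 : G), ∀ x, f (u⁻¹ * x) = f x := by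
  have hcont : Continuous fun p : G × G => p.1⁻¹ * p.2 := by fun_prop
  have hW : IsOpen {p : G × G | f (p.1⁻¹ * p.2) = f p.2} := by
    have h2 := (hf.comp_continuous hcont).prodMk (hf.comp_continuous continuous_snd)
    exact h2 {q : k × k | q.1 = q.2}
  have h1 : ∀ᶠ u in 𝓝 (1 : G), ∀ x ∈ tsupport f, f (u⁻¹ * x) = f x := by
    refine IsCompact.eventually_forall_of_forall_eventually hc ?_
    intro x _
    exact hW.mem_nhds (by simp)
  have h2 : ∀ᶠ u in 𝓝 (1 : G), ∀ x ∈ tsupport f, f (u⁻¹⁻¹ * x) = f x := by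
    have ht : Filter.Tendsto (fun u : G => u⁻¹) (𝓝 1) (𝓝 1) := by
      simpa using (continuous_inv (G := G)).tendsto 1
    exact ht.eventually h1
  filter_upwards [h1, h2] with u hu hu' x
  by_cases hx : x ∈ tsupport f
  · exact hu x hx
  · by_cases hy : u⁻¹ * x ∈ tsupport f
    · have := hu' _ hy
      simpa using this.symm
    · rw [image_eq_zero_of_notMem_tsupport hx, image_eq_zero_of_notMem_tsupport hy]

theorem isOpen_stabilizer_of_eventually {M : Type*} [AddCommGroup M] [Module k M]
    (ρ : Representation k G M) (x : M) (h : ∀ᶠ u in 𝓝 (1 : G), ρ u x = x) :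
    IsOpen {g : G | ρ g x = x} := by
  rw [isOpen_iff_mem_nhds]
  intro g hg
  have ht : Filter.Tendsto (fun a : G => g⁻¹ * a) (𝓝 g) (𝓝 1) := by
    simpa using (continuous_const_mul g⁻¹).tendsto g
  filter_upwards [ht.eventually h] with a ha
  have : ρ a x = ρ g (ρ (g⁻¹ * a) x) := by
    rw [← Module.End.mul_apply, ← map_mul]; simp
  show ρ a x = x
  rw [this, ha]; exact hg

theorem isSmooth_leftTranslation : IsSmooth k G (Rep.of (leftTranslation k G)) := by
  intro f
  refine isOpen_stabilizer_of_eventually k G (leftTranslation k G) f ?_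
  filter_upwards [eventually_leftTranslate_eq k G f.2.1 f.2.2] with u hu
  exact Subtype.ext (funext hu)

theorem isSmooth_rightTranslation : IsSmooth k G (Rep.of (rightTranslation k G)) := by
  intro f
  refine isOpen_stabilizer_of_eventually k G (rightTranslation k G) f ?_
  have h := eventually_leftTranslate_eq k G (f := fun x => f.1 x⁻¹)
    (f.2.1.comp_continuous continuous_inv) (f.2.2.comp_homeomorph (Homeomorph.inv G))
  filter_upwards [h] with u hu
  refine Subtype.ext (funext fun x => ?_)
  show f.1 (x * u) = f.1 x
  simpa using hu x⁻¹

/-- The smooth `G`-module `S = k(G)`, with `G` acting by left translations. -/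
abbrev leftRegular : SmoothRep.{u, v, max u v} k G :=
  ⟨Rep.of (leftTranslation k G), isSmooth_leftTranslation k G⟩

/-- The smooth `G`-module `S = k(G)` with the other action of `G`, by right translations. -/
abbrev rightRegular : SmoothRep.{u, v, max u v} k G :=
  ⟨Rep.of (rightTranslation k G), isSmooth_rightTranslation k G⟩

/-- The `k`-algebra `T = End_{k[G]}(S)ᵒᵖ`. (Multiplication in `End` is composition of maps.) -/
abbrev heckeT := (End (leftRegular k G))ᵐᵒᵖ

end Smooth

/-! ### Compactly supported finitely additive measures -/

section Measures

variable (k : Type u) [Field k]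
variable (X : Type*) [TopologicalSpace X] (Y : Type*) [TopologicalSpace Y]
variable (V : Type*) [AddCommGroup V] [Module k V] (W : Type*) [AddCommGroup W] [Module k W]

/-- The space `V[[X]]` of compactly supported finitely additive `V`-valued measures on the
clopen subsets of `X`. -/
def Meas : Submodule k (Clopens X → V) where
  carrier := {μ | (∀ A B : Clopens X, Disjoint A B → μ (A ⊔ B) = μ A + μ B) ∧
    ∃ K : Set X, IsCompact K ∧ ∀ A : Clopens X, Disjoint (A : Set X) K → μ A = 0}
  add_mem' := by
    rintro μ ν ⟨h1, K, hK, h2⟩ ⟨h1', K', hK', h2'⟩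
    refine ⟨fun A B h => ?_, K ∪ K', hK.union hK', fun A h => ?_⟩
    · simp only [Pi.add_apply, h1 A B h, h1' A B h]; abel
    · rw [Set.disjoint_union_right] at h
      simp [h2 A h.1, h2' A h.2]
  zero_mem' := ⟨fun _ _ _ => by simp, ∅, isCompact_empty, fun _ _ => rfl⟩
  smul_mem' := by
    rintro c μ ⟨h1, K, hK, h2⟩
    exact ⟨fun A B h => by simp [h1 A B h], K, hK, fun A h => by simp [h2 A h]⟩

variable {X Y}

/-- The point measure at `x` with the value `a`. -/
def pointMeas (x : X) (a : V) : Meas k X V :=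
  ⟨fun A => by classical exact if x ∈ A then a else 0, by
    classical
    refine ⟨fun A B h => ?_, {x}, isCompact_singleton, fun A h => ?_⟩
    · have hd : ¬ (x ∈ A ∧ x ∈ B) := by
        rintro ⟨ha, hb⟩
        have : x ∈ A ⊓ B := ⟨ha, hb⟩
        rw [h.eq_bot] at this
        exact this
      have hu : x ∈ A ⊔ B ↔ x ∈ A ∨ x ∈ B := Iff.rfl
      by_cases ha : x ∈ A <;> by_cases hb : x ∈ B <;> simp_all
    · have : x ∉ A := fun hx => Set.disjoint_left.1 h hx rfl
      simp [this]⟩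

/-- The preimage of a clopen set under a continuous map. -/
def clopenPreimage {f : X → Y} (hf : Continuous f) (B : Clopens Y) : Clopens X :=
  ⟨f ⁻¹' B, B.isClopen.preimage hf⟩

/-- Pushforward of measures along a continuous map. -/
def pushforward {f : X → Y} (hf : Continuous f) : Meas k X V →ₗ[k] Meas k Y V where
  toFun μ := ⟨fun B => μ.1 (clopenPreimage hf B), by
    obtain ⟨μ, h1, K, hK, h2⟩ := μ
    refine ⟨fun A B h => ?_, f '' K, hK.image hf, fun A h => ?_⟩
    · refine h1 (clopenPreimage hf A) (clopenPreimage hf B) ?_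
      rw [disjoint_iff] at h ⊢
      ext x
      exact (SetLike.ext_iff.1 h (f x))
    · refine h2 _ (Set.disjoint_left.2 fun x hx hxK => ?_)
      exact Set.disjoint_left.1 h hx ⟨x, hxK, rfl⟩⟩
  map_add' _ _ := rfl
  map_smul' _ _ := rfl

variable {V W}

/-- The map `V[[X]] → W[[X]]` induced by a linear map `V → W`. -/
def mapValues (φ : V →ₗ[k] W) : Meas k X V →ₗ[k] Meas k X W where
  toFun μ := ⟨fun A => φ (μ.1 A), by
    obtain ⟨μ, h1, K, hK, h2⟩ := μ
    exact ⟨fun A B h => by simp [h1 A B h], K, hK, fun A h => by simp [h2 A h]⟩⟩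
  map_add' _ _ := Subtype.ext (funext fun _ => map_add φ _ _)
  map_smul' _ _ := Subtype.ext (funext fun _ => map_smul φ _ _)

/-- The natural injection `V[[X × Y]] → V[[X]][[Y]]`, `μ ↦ (B ↦ (A ↦ μ (A × B)))`. -/
def curryMeas : Meas k (X × Y) V →ₗ[k] Meas k Y (Meas k X V) where
  toFun μ := ⟨fun B => ⟨fun A => μ.1 (A ×ˢ B), by
      obtain ⟨μ, h1, K, hK, h2⟩ := μ
      refine ⟨fun A A' h => ?_, Prod.fst '' K, hK.image continuous_fst, fun A h => ?_⟩
      · have he : (A ⊔ A') ×ˢ B = (A ×ˢ B) ⊔ (A' ×ˢ B) :=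
          SetLike.coe_injective Set.union_prod
        dsimp only
        rw [he]
        refine h1 _ _ ?_
        rw [disjoint_iff] at h ⊢
        ext x
        refine ⟨fun hx => ?_, fun hx => hx.elim⟩
        exact (SetLike.ext_iff.1 h x.1).1 ⟨hx.1.1, hx.2.1⟩
      · refine h2 _ (Set.disjoint_left.2 fun x hx hxK => ?_)
        exact Set.disjoint_left.1 h hx.1 ⟨x, hxK, rfl⟩⟩, by
    obtain ⟨μ, h1, K, hK, h2⟩ := μ
    refine ⟨fun B B' h => Subtype.ext (funext fun A => ?_), Prod.snd '' K,
      hK.image continuous_snd, fun B h => Subtype.ext (funext fun A => ?_)⟩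
    · have he : A ×ˢ (B ⊔ B') = (A ×ˢ B) ⊔ (A ×ˢ B') :=
        SetLike.coe_injective Set.prod_union
      show μ (A ×ˢ (B ⊔ B')) = μ (A ×ˢ B) + μ (A ×ˢ B')
      rw [he]
      refine h1 _ _ ?_
      rw [disjoint_iff] at h ⊢
      ext x
      refine ⟨fun hx => ?_, fun hx => hx.elim⟩
      exact (SetLike.ext_iff.1 h x.2).1 ⟨hx.1.2, hx.2.2⟩
    · refine h2 _ (Set.disjoint_left.2 fun x hx hxK => ?_)
      exact Set.disjoint_left.1 h hx.2 ⟨x, hxK, rfl⟩⟩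
  map_add' _ _ := rfl
  map_smul' _ _ := rfl

variable {k}

/-- The preimage of a subset under a locally constant map, as a clopen set. -/
def lcPreimage {ι : Type*} {h : X → ι} (hh : IsLocallyConstant h) (P : Set ι) : Clopens X :=
  ⟨h ⁻¹' P, ⟨⟨by rw [← Set.preimage_compl]; exact hh _⟩, hh P⟩⟩

/-- The integral `∫_X dμ_x (h x)` of a locally constant `N`-valued function `h` against a
compactly supported `Hom(N, V)`-valued measure `μ`: the (finite) sum over the values `m` of `h`
of `μ (h⁻¹ m) m`. -/
def integral {h : X → W} (hh : IsLocallyConstant h) (μ : Meas k X (W →ₗ[k] V)) : V :=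
  ∑ᶠ m : W, μ.1 (lcPreimage hh {m}) m

section lemmas

variable {ι : Type*} {h : X → ι} (hh : IsLocallyConstant h)

theorem meas_bot (μ : Meas k X V) : μ.1 ⊥ = 0 := by
  have := μ.2.1 ⊥ ⊥ disjoint_bot_left
  simpa using this

theorem exists_finset_values (μ : Meas k X V) : ∃ S : Finset ι,
    ∀ P : Set ι, Disjoint P (S : Set ι) → μ.1 (lcPreimage hh P) = 0 := by
  obtain ⟨K, hK, h2⟩ := μ.2.2
  have hfin : (h '' K).Finite := by
    let _ : TopologicalSpace ι := ⊥
    have : DiscreteTopology ι := ⟨rfl⟩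
    exact (hK.image hh.continuous).finite_of_discrete
  refine ⟨hfin.toFinset, fun P hP => h2 _ (Set.disjoint_left.2 fun x hx hxK => ?_)⟩
  exact Set.disjoint_left.1 hP hx (by simpa using ⟨x, hxK, rfl⟩)

theorem meas_lcPreimage_union (μ : Meas k X V) {P Q : Set ι} (hPQ : Disjoint P Q) :
    μ.1 (lcPreimage hh (P ∪ Q)) = μ.1 (lcPreimage hh P) + μ.1 (lcPreimage hh Q) := by
  refine μ.2.1 (lcPreimage hh P) (lcPreimage hh Q) ?_
  rw [disjoint_iff]
  ext x
  exact ⟨fun hx => (Set.disjoint_left.1 hPQ hx.1 hx.2).elim, fun hx => hx.elim⟩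

theorem meas_lcPreimage_finset (μ : Meas k X V) (T : Finset ι) :
    μ.1 (lcPreimage hh (T : Set ι)) = ∑ i ∈ T, μ.1 (lcPreimage hh {i}) := by
  classical
  induction T using Finset.induction_on with
  | empty =>
    have : lcPreimage hh ((∅ : Finset ι) : Set ι) = ⊥ := by
      ext x; simp [lcPreimage]
    rw [this, meas_bot, Finset.sum_empty]
  | insert a T ha ih =>
    rw [Finset.sum_insert ha, Finset.coe_insert, Set.insert_eq,
      meas_lcPreimage_union hh μ (by simpa using ha), ih]

theorem integral_comp (φ : ι → W) (hφ : IsLocallyConstant (φ ∘ h))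
    (μ : Meas k X (W →ₗ[k] V)) :
    integral hφ μ = ∑ᶠ i, μ.1 (lcPreimage hh {i}) (φ i) := by
  classical
  obtain ⟨S, hS⟩ := exists_finset_values hh μ
  have key : ∀ P : Set ι, μ.1 (lcPreimage hh P) =
      ∑ i ∈ S with i ∈ P, μ.1 (lcPreimage hh {i}) := by
    intro P
    rw [← meas_lcPreimage_finset]
    have hd : Disjoint ((S.filter (· ∈ P) : Finset ι) : Set ι) (P \ (S : Set ι)) := by
      rw [Set.disjoint_left]; intro i hi hi'
      simp at hi hi'; exact hi'.2 hi.1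
    have hu : P = ((S.filter (· ∈ P) : Finset ι) : Set ι) ∪ (P \ (S : Set ι)) := by
      ext i; by_cases hi : i ∈ S <;> simp [hi]
    conv_lhs => rw [hu]
    rw [meas_lcPreimage_union hh μ hd, hS _ Set.disjoint_sdiff_left, add_zero]
  have hL : ∀ m : W, μ.1 (lcPreimage hφ {m}) m =
      ∑ i ∈ S with φ i = m, μ.1 (lcPreimage hh {i}) (φ i) := by
    intro m
    have : lcPreimage hφ {m} = lcPreimage hh (φ ⁻¹' {m}) := rfl
    rw [this, key, LinearMap.sum_apply]
    refine Finset.sum_congr rfl fun i hi => ?_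
    have : φ i = m := by simpa using (Finset.mem_filter.1 hi).2
    rw [this]
  unfold integral
  simp_rw [hL]
  rw [finsum_eq_sum_of_support_subset (s := S.image φ), Finset.sum_fiberwise_of_maps_to (g := φ) (t := S.image φ)
    (fun i hi => Finset.mem_image_of_mem φ hi) (fun i => μ.1 (lcPreimage hh {i}) (φ i))]
  · symm
    refine finsum_eq_sum_of_support_subset _ ?_
    intro i hi
    by_contra hiS
    refine hi ?_
    dsimp only
    rw [hS {i} (by simpa using hiS)]; rfl
  · intro m hm
    by_contra hmS
    refine hm ?_
    dsimp only
    refine Finset.sum_eq_zero fun i hi => ?_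
    rw [Finset.mem_filter] at hi
    exact (hmS (by simpa using ⟨i, hi.1, hi.2⟩)).elim

theorem finite_support_eval (φ : ι → W) (μ : Meas k X (W →ₗ[k] V)) :
    (Function.support fun i => μ.1 (lcPreimage hh {i}) (φ i)).Finite := by
  obtain ⟨S, hS⟩ := exists_finset_values hh μ
  refine S.finite_toSet.subset fun i hi => ?_
  by_contra hiS
  refine hi ?_
  dsimp only
  rw [hS {i} (by simpa using hiS)]; rfl

end lemmas

theorem integral_add_meas {h : X → W} (hh : IsLocallyConstant h) (μ ν : Meas k X (W →ₗ[k] V)) :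
    integral hh (μ + ν) = integral hh μ + integral hh ν := by
  exact finsum_add_distrib (finite_support_eval hh id μ) (finite_support_eval hh id ν)

theorem integral_smul_meas {h : X → W} (hh : IsLocallyConstant h) (c : k)
    (μ : Meas k X (W →ₗ[k] V)) : integral hh (c • μ) = c • integral hh μ := by
  exact (smul_finsum' c (finite_support_eval hh id μ)).symm

theorem integral_add {h h' : X → W} (hh : IsLocallyConstant h) (hh' : IsLocallyConstant h')
    (hs : IsLocallyConstant (h + h')) (μ : Meas k X (W →ₗ[k] V)) :
    integral hs μ = integral hh μ + integral hh' μ := by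
  have hp := hh.prodMk hh'
  rw [show integral hs μ = _ from integral_comp hp (fun p => p.1 + p.2) hs μ,
    show integral hh μ = _ from integral_comp hp (fun p => p.1) hh μ,
    show integral hh' μ = _ from integral_comp hp (fun p => p.2) hh' μ,
    ← finsum_add_distrib (finite_support_eval hp _ μ) (finite_support_eval hp _ μ)]
  exact finsum_congr fun p => map_add _ _ _

theorem integral_smul {h : X → W} (hh : IsLocallyConstant h) (c : k)
    (hs : IsLocallyConstant (c • h)) (μ : Meas k X (W →ₗ[k] V)) :
    integral hs μ = c • integral hh μ := by
  rw [show integral hs μ = _ from integral_comp hh (fun m => c • m) hs μ]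
  refine Eq.trans ?_ (smul_finsum' c (finite_support_eval hh id μ)).symm
  exact finsum_congr fun p => map_smul _ _ _

end Measures

/-! ### Contramodules -/

section Contra

variable (k : Type u) (G : Type v) [Field k] [Group G] [TopologicalSpace G]
  [IsTopologicalGroup G]

/-- A `G`-contramodule over `k`: a vector space `P` with a linear contraaction map
`π : P[[G]] → P` which is contraassociative (the two maps `P[[G × G]] ⇉ P[[G]]`, the pushforward
along the multiplication and the composition `P[[G × G]] → P[[G]][[G]] → P[[G]]`, have equal
compositions with `π`) and contraunital. -/
structure Contra where
  /-- The underlying vector space. -/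
  carrier : Type w
  [addCommGroup : AddCommGroup carrier]
  [module : Module k carrier]
  /-- The contraaction map. -/
  act : Meas k G carrier →ₗ[k] carrier
  contraassoc : ∀ μ : Meas k (G × G) carrier,
    act (pushforward k carrier (continuous_mul : Continuous fun p : G × G => p.1 * p.2) μ) =
      act (mapValues k act (curryMeas k μ))
  contraunit : ∀ x : carrier, act (pointMeas k carrier (1 : G) x) = x

attribute [instance] Contra.addCommGroup Contra.module

variable {k G}

/-- Morphisms of contramodules: linear maps commuting with the contraactions. -/
@[ext]
structure Contra.Hom (P Q : Contra.{u, v, w} k G) where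
  /-- The underlying linear map. -/
  lin : P.carrier →ₗ[k] Q.carrier
  comm : ∀ μ : Meas k G P.carrier, lin (P.act μ) = Q.act (mapValues k lin μ)

instance : Category (Contra.{u, v, w} k G) where
  Hom P Q := Contra.Hom P Q
  id P := ⟨LinearMap.id, fun _ => rfl⟩
  comp f g := ⟨g.lin ∘ₗ f.lin, fun μ => by
    rw [LinearMap.comp_apply, f.comm, g.comm]; rfl⟩

variable (k G) in
/-- The forgetful functor from `G`-contramodules to `k`-vector spaces. -/
def contraForget : Contra.{u, v, w} k G ⥤ ModuleCat.{w} k where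
  obj P := ModuleCat.of k P.carrier
  map f := ModuleCat.ofHom f.lin

theorem orbit_isLocallyConstant (N : SmoothRep.{u, v, w} k G) (n : N.obj.V) :
    IsLocallyConstant fun g : G => N.obj.ρ g n := by
  rw [IsLocallyConstant.iff_isOpen_fiber_apply]
  intro g
  have : (fun a : G => N.obj.ρ a n) ⁻¹' {N.obj.ρ g n} =
      (fun a => g⁻¹ * a) ⁻¹' {a | N.obj.ρ a n = n} := by
    ext a
    simp only [Set.mem_preimage, Set.mem_singleton_iff, Set.mem_ofPred_eq, map_mul,
      Module.End.mul_apply]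
    constructor
    · intro h; rw [h, ← Module.End.mul_apply, ← map_mul]; simp
    · intro h
      conv_rhs => rw [← h]
      rw [← Module.End.mul_apply, ← map_mul]; simp
  rw [this]
  exact (N.property n).preimage (continuous_const_mul g⁻¹)

/-- The contraaction on `Hom_k(N, V)` for a smooth `G`-module `N`:
`π(μ)(n) = ∫_G dμ_g (g n)`. -/
def homAct (N : SmoothRep.{u, v, w} k G) (V : ModuleCat.{w} k) :
    Meas k G (N.obj.V →ₗ[k] V) →ₗ[k] (N.obj.V →ₗ[k] V) where
  toFun μ :=
    { toFun := fun n => integral (orbit_isLocallyConstant N n) μ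
      map_add' := fun n n' => by
        have he : (fun g : G => N.obj.ρ g (n + n')) =
          (fun g => N.obj.ρ g n) + (fun g => N.obj.ρ g n') := by ext g; simp
        have hs := orbit_isLocallyConstant N (n + n')
        rw [← integral_add (orbit_isLocallyConstant N n) (orbit_isLocallyConstant N n')
          (he ▸ hs)]
        congr 1
      map_smul' := fun c n => by
        have he : (fun g : G => N.obj.ρ g (c • n)) = c • (fun g => N.obj.ρ g n) := by
          ext g; simp
        have hs := orbit_isLocallyConstant N (c • n)
        rw [RingHom.id_apply, ← integral_smul (orbit_isLocallyConstant N n) c (he ▸ hs)]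
        congr 1 }
  map_add' μ ν := LinearMap.ext fun n => integral_add_meas _ μ ν
  map_smul' c μ := LinearMap.ext fun n => integral_smul_meas _ c μ

/-- The `G`-contramodule `Hom_k(N, V)` for a smooth `G`-module `N` and a vector space `V`. -/
def homContra (N : SmoothRep.{u, v, w} k G) (V : ModuleCat.{w} k) : Contra.{u, v, w} k G where
  carrier := N.obj.V →ₗ[k] V
  act := homAct N V
  contraassoc μ := by
    refine LinearMap.ext fun n => ?_
    have ho := orbit_isLocallyConstant N n
    have h1 : IsLocallyConstant fun p : G × G => N.obj.ρ p.2 n :=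
      ho.comp_continuous continuous_snd
    have h2 : IsLocallyConstant fun p : G × G => N.obj.ρ (p.1 * p.2) n :=
      ho.comp_continuous continuous_mul
    have hp := h1.prodMk h2
    have e1 : homAct N V (pushforward k (N.obj.V →ₗ[k] V)
        (continuous_mul : Continuous fun p : G × G => p.1 * p.2) μ) n = integral h2 μ := rfl
    rw [e1, show integral h2 μ = _ from integral_comp hp Prod.snd h2 μ,
      finsum_curry _ (finite_support_eval hp Prod.snd μ)]
    refine finsum_congr fun m => finsum_congr fun m' => ?_
    refine congrArg (fun A => μ.1 A m') (SetLike.ext fun p => ?_)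
    show ((_, _) : N.obj.V × N.obj.V) = (m, m') ↔ N.obj.ρ p.1 m = m' ∧ N.obj.ρ p.2 n = m
    rw [Prod.mk.injEq, map_mul, Module.End.mul_apply]
    constructor
    · rintro ⟨rfl, rfl⟩; exact ⟨rfl, rfl⟩
    · rintro ⟨rfl, rfl⟩; exact ⟨rfl, rfl⟩
  contraunit x := by
    classical
    refine LinearMap.ext fun n => ?_
    have hval : ∀ m, (pointMeas k (N.obj.V →ₗ[k] V) (1 : G) x).1
        (lcPreimage (orbit_isLocallyConstant N n) {m}) m = if n = m then x m else 0 := by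
      intro m
      have hm : (1 : G) ∈ lcPreimage (orbit_isLocallyConstant N n) {m} ↔ n = m := by
        show N.obj.ρ 1 n = m ↔ n = m
        simp
      show (if (1 : G) ∈ lcPreimage (orbit_isLocallyConstant N n) {m} then x else 0) m = _
      by_cases h : n = m
      · rw [if_pos (hm.2 h), if_pos h]
      · rw [if_neg (mt hm.1 h), if_neg h]; rfl
    show ∑ᶠ m, _ = _
    rw [finsum_congr hval, finsum_eq_single _ n]
    · simp
    · intro m hm
      simp [hm.symm]

end Contra

end SmoothContra

end

open SmoothContra

/-! Both algebras are described by "distributions" on `G`. An endomorphism `t` of `k(G)` commuting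
with left translations is determined by m(A) = (t 1_A)(1), a finitely additive function of compact
open sets A. Compactness of the support of t(1_U) says that, for each compact open subgroup U, only
finitely many cosets gU have m(gU) ≠ 0 (`finite_support_coeffs`); refining U gives compatible
elements of k[G/U] (`mapDomain_coeffs`). Hence a function φ invariant under right translations by
some U has an integral `ev t φ` = ∫ φ dm, a finite sum independent of the choice of U (`ev_eq`).

(a) Orbit maps of smooth modules are such functions, so `t` acts by n ↦ ∫ gn dm(g) (`smoothAct`).
Conversely, a U-fixed vector of N is the image of the basis vector at the trivial coset under a
morphism k[G/U] → N, so an endomorphism of the forgetful functor is determined by its values on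
these basis vectors, and these values are read off from its action in S'
(`coeffs_equivariantOfEnd`).

(b) On a contramodule, `t` should act by p ↦ ∫ p·x dm(x), but m need not be compactly supported.
Writing x = repr(x) rem(x), with rem(x) in a fixed compact open subgroup, replaces this by the
contraaction of the compactly supported measure C ↦ ∫ 1_{rem x ∈ C} p·repr(x) dm(x) (`contraEval`).
On Hom(N, V) this is precomposition with the action of `t` in N (`contraEval_homContra`).

For the converse, an endomorphism η of the forgetful functor gives the endomorphism η_{Hom(N,N)}(id)
of each smooth N (`smoothOfContra`). That η is recovered from it follows because End(k(G)) is itself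
a contramodule, inside Hom(S', S'), and for each p in P the map t ↦ p·t is a contramodule morphism
taking the identity to p: η is determined by its value at the identity of End(k(G)). The hard point
is that t ↦ p·t commutes with contraactions (`contraEval_act`). It rests on a Fubini-type formula
(`ev_smoothInt`) and on contraassociativity, which makes the contraaction independent of how a
product is factored (`Contra.act_eq_of_mul_eq`). -/

namespace SmoothContra

/-! ### Compact open subgroups and uniformly locally constant functions -/

section Uniform

variable (k : Type u) {G : Type v} [Field k] [Group G] [TopologicalSpace G]

/-- A subgroup which is open and compact. -/
structure IsCompactOpen (U : Subgroup G) : Prop where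
  isOpen : IsOpen (U : Set G)
  isCompact : IsCompact (U : Set G)

theorem IsCompactOpen.inf [T2Space G] {U W : Subgroup G} (hU : IsCompactOpen U)
    (hW : IsCompactOpen W) : IsCompactOpen (U ⊓ W) :=
  ⟨hU.isOpen.inter hW.isOpen, hU.isCompact.inter hW.isCompact⟩

variable [IsTopologicalGroup G]

/-- Van Dantzig's theorem: take the stabilizer, under left translations, of the indicator of a
compact open neighbourhood W of 1. It is open because the indicator is locally constant with compact
support, and it lies in W because W contains 1. -/
theorem exists_isCompactOpen_subset [LocallyCompactSpace G] [TotallyDisconnectedSpace G]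
    [T2Space G] {s : Set G} (hs : s ∈ 𝓝 (1 : G)) :
    ∃ U : Subgroup G, IsCompactOpen U ∧ (U : Set G) ⊆ s := by
  classical
  obtain ⟨K, hK, hKs, hKc⟩ := local_compact_nhds hs
  obtain ⟨W, hW, h1W, hWK⟩ := (loc_compact_Haus_tot_disc_of_zero_dim (H := G)).mem_nhds_iff.1 hK
  have hWc : IsCompact W := hKc.of_isClosed_subset hW.isClosed hWK
  -- The field ℚ is auxiliary: any field makes `eventually_leftTranslate_eq` applicable to the
  -- indicator.
  let f : G → ℚ := fun x => if x ∈ W then 1 else 0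
  have hf : IsLocallyConstant f := by
    rw [IsLocallyConstant.iff_exists_open]
    intro x
    by_cases hx : x ∈ W
    · exact ⟨W, hW.isOpen, hx, fun y hy => by simp [f, hx, hy]⟩
    · exact ⟨Wᶜ, hW.compl.isOpen, hx, fun y hy => by
        have : y ∉ W := hy
        simp [f, hx, this]⟩
  have hfc : HasCompactSupport f :=
    HasCompactSupport.intro hWc fun x hx => by simp [f, hx]
  have hmem : ∀ x, f x = 1 ↔ x ∈ W := fun x => by by_cases hx : x ∈ W <;> simp [f, hx]
  have hev := eventually_leftTranslate_eq ℚ G hf hfc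
  let U : Subgroup G :=
    { carrier := {u | ∀ x, f (u⁻¹ * x) = f x}
      mul_mem' := fun {a b} ha hb x => by
        rw [mul_inv_rev, mul_assoc, hb, ha]
      one_mem' := fun x => by simp
      inv_mem' := fun {a} ha x => by rw [inv_inv, ← ha]; simp }
  have hUo : IsOpen (U : Set G) := Subgroup.isOpen_of_mem_nhds U (g := 1) hev
  have hUW : (U : Set G) ⊆ W := fun u hu => by
    have := hu u
    rw [inv_mul_cancel] at this
    exact (hmem u).1 (this ▸ (hmem 1).2 h1W)
  exact ⟨U, ⟨hUo, hWc.of_isClosed_subset (U.isClosed_of_isOpen hUo) hUW⟩,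
    hUW.trans (hWK.trans hKs)⟩

variable (G) in
/-- The functions on `G` invariant under right translations by a neighbourhood of `1`. -/
def unifFun (V : Type*) [AddCommGroup V] [Module k V] : Submodule k (G → V) where
  carrier := {φ | ∀ᶠ u in 𝓝 (1 : G), ∀ x, φ (x * u) = φ x}
  add_mem' := fun ha hb => by
    filter_upwards [ha, hb] with u hu hu' x
    simp only [Pi.add_apply, hu x, hu' x]
  zero_mem' := Filter.Eventually.of_forall fun _ _ => rfl
  smul_mem' := fun c φ hφ => by
    filter_upwards [hφ] with u hu x
    simp only [Pi.smul_apply, hu x]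

theorem exists_isCompactOpen_invariant [LocallyCompactSpace G] [TotallyDisconnectedSpace G]
    [T2Space G] {X : Type*} {φ : G → X} (hφ : ∀ᶠ u in 𝓝 (1 : G), ∀ x, φ (x * u) = φ x) :
    ∃ U : Subgroup G, IsCompactOpen U ∧ ∀ x, ∀ u ∈ U, φ (x * u) = φ x := by
  obtain ⟨U, hU, h⟩ := exists_isCompactOpen_subset hφ
  exact ⟨U, hU, fun x u hu => h hu x⟩

theorem eventually_of_isCompactOpen {X : Type*} {φ : G → X} {U : Subgroup G}
    (hU : IsCompactOpen U) (h : ∀ x, ∀ u ∈ U, φ (x * u) = φ x) :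
    ∀ᶠ u in 𝓝 (1 : G), ∀ x, φ (x * u) = φ x := by
  filter_upwards [hU.isOpen.mem_nhds U.one_mem] with u hu x using h x u hu

theorem eq_of_mk_eq {X : Type*} {φ : G → X} {U : Subgroup G}
    (h : ∀ x, ∀ u ∈ U, φ (x * u) = φ x) {x y : G} (hxy : (x : G ⧸ U) = y) : φ x = φ y := by
  have := h x _ (QuotientGroup.eq.1 hxy)
  rw [← this]; simp

theorem IsCompactOpen.finite_cosets {U : Subgroup G} (hU : IsCompactOpen U) {K : Set G}
    (hK : IsCompact K) : ((fun x : G => (x : G ⧸ U)) '' K).Finite := by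
  have : DiscreteTopology (G ⧸ U) := QuotientGroup.discreteTopology hU.isOpen
  exact (hK.image QuotientGroup.continuous_mk).finite_of_discrete

/-- The indicator function of a coset of a compact open subgroup. -/
noncomputable def cosetInd {U : Subgroup G} (hU : IsCompactOpen U) (q : G ⧸ U) :
    testFunctions k G :=
  ⟨fun x => by classical exact if (x : G ⧸ U) = q then 1 else 0, by
    classical
    constructor
    · have : DiscreteTopology (G ⧸ U) := QuotientGroup.discreteTopology hU.isOpen
      exact (IsLocallyConstant.of_discrete (X := G ⧸ U) fun p => if p = q then (1 : k) else 0
        ).comp_continuous QuotientGroup.continuous_mk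
    · obtain ⟨g, rfl⟩ := QuotientGroup.mk_surjective q
      have hK : IsCompact ((fun x => g⁻¹ * x) ⁻¹' (U : Set G)) :=
        (Homeomorph.mulLeft g⁻¹).isCompact_preimage.2 hU.isCompact
      have hcl : IsClosed ((fun x => g⁻¹ * x) ⁻¹' (U : Set G)) :=
        (U.isClosed_of_isOpen hU.isOpen).preimage (continuous_const_mul g⁻¹)
      refine hK.of_isClosed_subset (isClosed_tsupport _) (closure_minimal (fun x hx => ?_) hcl)
      by_contra hxU
      refine hx (if_neg fun h => hxU ?_)
      exact QuotientGroup.eq.1 h.symm⟩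

open Classical in
theorem cosetInd_apply {U : Subgroup G} (hU : IsCompactOpen U) (q : G ⧸ U) (x : G) :
    (cosetInd k hU q).1 x = if (x : G ⧸ U) = q then 1 else 0 := rfl

theorem leftTranslation_cosetInd {U : Subgroup G} (hU : IsCompactOpen U) (g : G) (q : G ⧸ U) :
    leftTranslation k G g (cosetInd k hU q) = cosetInd k hU (g • q) := by
  classical
  refine Subtype.ext (funext fun x => ?_)
  change (cosetInd k hU q).1 (g⁻¹ * x) = _
  rw [cosetInd_apply, cosetInd_apply]
  refine if_congr ?_ rfl rfl
  rw [← inv_smul_eq_iff]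
  rfl

/-! ### Equivariant endomorphisms as compatible families of coefficients on cosets -/

variable (G) in
/-- The endomorphisms of `k(G)` commuting with left translations. -/
def equivariantEnd : Submodule k (testFunctions k G →ₗ[k] testFunctions k G) where
  carrier := {t | ∀ g f, t (leftTranslation k G g f) = leftTranslation k G g (t f)}
  add_mem' := fun ha hb g f => by
    rw [LinearMap.add_apply, ha g f, hb g f, LinearMap.add_apply, map_add]
  zero_mem' := fun g f => by simp
  smul_mem' := fun c t ht g f => by
    rw [LinearMap.smul_apply, ht g f, LinearMap.smul_apply, map_smul]

instance : AddCommGroup (equivariantEnd k G) :=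
  Submodule.addCommGroup (M := testFunctions k G →ₗ[k] testFunctions k G) _

variable {k}

theorem equivariantEnd_apply (t : equivariantEnd k G) (f : testFunctions k G) (x : G) :
    (t.1 f).1 x = (t.1 (leftTranslation k G x⁻¹ f)).1 1 := by
  rw [t.2 x⁻¹ f]
  change _ = (t.1 f).1 (x⁻¹⁻¹ * 1)
  simp

/-- By equivariance the coefficient at gU is the value of t(1_U) at g⁻¹, and the inverse of the
compact support of t(1_U) meets finitely many cosets. -/
theorem finite_support_coeffs {U : Subgroup G} (hU : IsCompactOpen U) (t : equivariantEnd k G) :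
    (Function.support fun q : G ⧸ U => (t.1 (cosetInd k hU q)).1 1).Finite := by
  have hK := (t.1 (cosetInd k hU ((1 : G) : G ⧸ U))).2.2
  refine (hU.finite_cosets ((Homeomorph.inv G).isCompact_preimage.2 hK)).subset fun q hq => ?_
  obtain ⟨g, rfl⟩ := QuotientGroup.mk_surjective q
  refine ⟨g, ?_, rfl⟩
  refine subset_tsupport _ fun h0 => hq ?_
  dsimp only
  change (t.1 (cosetInd k hU ((1 : G) : G ⧸ U))).1 g⁻¹ = 0 at h0
  rw [equivariantEnd_apply, inv_inv, leftTranslation_cosetInd] at h0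
  rw [← h0]
  simp

/-- The finitely supported function on `G ⧸ U` defined by an endomorphism of `k(G)`. -/
noncomputable def coeffs {U : Subgroup G} (hU : IsCompactOpen U) (t : equivariantEnd k G) :
    G ⧸ U →₀ k :=
  Finsupp.ofSupportFinite _ (finite_support_coeffs hU t)

theorem coeffs_apply {U : Subgroup G} (hU : IsCompactOpen U) (t : equivariantEnd k G)
    (q : G ⧸ U) : coeffs hU t q = (t.1 (cosetInd k hU q)).1 1 := rfl

theorem coeffs_add {U : Subgroup G} (hU : IsCompactOpen U) (t t' : equivariantEnd k G) :
    coeffs hU (t + t') = coeffs hU t + coeffs hU t' := Finsupp.ext fun _ => rfl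

theorem coeffs_smul {U : Subgroup G} (hU : IsCompactOpen U) (c : k) (t : equivariantEnd k G) :
    coeffs hU (c • t) = c • coeffs hU t := Finsupp.ext fun _ => rfl

/-- The projection of cosets for an inclusion of subgroups. -/
def cosetProj {W U : Subgroup G} (h : W ≤ U) : G ⧸ W → G ⧸ U :=
  Quotient.map' id fun a b hab => by
    rw [QuotientGroup.leftRel_apply] at hab ⊢
    exact h hab

theorem cosetProj_mk {W U : Subgroup G} (h : W ≤ U) (x : G) :
    cosetProj h (x : G ⧸ W) = (x : G ⧸ U) := rfl

theorem finite_fiber_cosetProj {W U : Subgroup G} (hW : IsCompactOpen W) (hU : IsCompactOpen U)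
    (h : W ≤ U) (q : G ⧸ U) : {p : G ⧸ W | cosetProj h p = q}.Finite := by
  obtain ⟨g, rfl⟩ := QuotientGroup.mk_surjective q
  have hK : IsCompact ((fun x => g⁻¹ * x) ⁻¹' (U : Set G)) :=
    (Homeomorph.mulLeft g⁻¹).isCompact_preimage.2 hU.isCompact
  refine (hW.finite_cosets hK).subset fun p hp => ?_
  obtain ⟨x, rfl⟩ := QuotientGroup.mk_surjective p
  exact ⟨x, QuotientGroup.eq.1 (Eq.symm hp), rfl⟩

theorem cosetInd_eq_sum {W U : Subgroup G} (hW : IsCompactOpen W) (hU : IsCompactOpen U)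
    (h : W ≤ U) (q : G ⧸ U) :
    cosetInd k hU q = ∑ p ∈ (finite_fiber_cosetProj hW hU h q).toFinset, cosetInd k hW p := by
  classical
  refine Subtype.ext (funext fun x => ?_)
  rw [Submodule.coe_sum, Finset.sum_apply]
  simp_rw [cosetInd_apply]
  rw [Finset.sum_ite_eq]
  refine if_congr ?_ rfl rfl
  simp [cosetProj_mk]

/-- Finite additivity of A ↦ (t 1_A)(1): a coset of U is a finite disjoint union of cosets of W. -/
theorem mapDomain_coeffs {W U : Subgroup G} (hW : IsCompactOpen W) (hU : IsCompactOpen U)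
    (h : W ≤ U) (t : equivariantEnd k G) :
    Finsupp.mapDomain (cosetProj h) (coeffs hW t) = coeffs hU t := by
  classical
  ext q
  rw [coeffs_apply, cosetInd_eq_sum hW hU h, map_sum, Submodule.coe_sum, Finset.sum_apply,
    Finsupp.mapDomain, Finsupp.sum_apply, Finsupp.sum]
  simp_rw [Finsupp.single_apply, ← coeffs_apply]
  rw [← Finset.sum_filter]
  refine Finset.sum_subset (fun p hp => ?_) fun p hp hp' => ?_
  · simpa using (Finset.mem_filter.1 hp).2
  · by_contra h0
    exact hp' (Finset.mem_filter.2 ⟨Finsupp.mem_support_iff.2 h0, by simpa using hp⟩)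

/-! ### Integration of uniformly locally constant functions -/

section Evaluation

variable {V : Type*} [AddCommGroup V] [Module k V]

theorem linearCombination_coeffs_of_le {W U : Subgroup G} (hW : IsCompactOpen W)
    (hU : IsCompactOpen U) (h : W ≤ U) (t : equivariantEnd k G) {φ : G → V}
    (hφ : ∀ x, ∀ u ∈ U, φ (x * u) = φ x) :
    Finsupp.linearCombination k (fun q : G ⧸ U => φ q.out) (coeffs hU t) =
      Finsupp.linearCombination k (fun q : G ⧸ W => φ q.out) (coeffs hW t) := by
  rw [← mapDomain_coeffs hW hU h, Finsupp.linearCombination_mapDomain]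
  congr 2
  funext p
  refine eq_of_mk_eq hφ ?_
  rw [QuotientGroup.out_eq', ← cosetProj_mk h, QuotientGroup.out_eq']

variable [LocallyCompactSpace G] [TotallyDisconnectedSpace G] [T2Space G]

open Classical in
/-- The integral `∫ φ(x) dm(x)` of a uniformly locally constant function against the finitely
additive function `m` on compact open sets defined by an endomorphism of `k(G)`. -/
noncomputable def ev (t : equivariantEnd k G) (φ : G → V) : V :=
  if h : ∃ U : Subgroup G, IsCompactOpen U ∧ ∀ x, ∀ u ∈ U, φ (x * u) = φ x then
    Finsupp.linearCombination k (fun q : G ⧸ h.choose => φ q.out) (coeffs h.choose_spec.1 t)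
  else 0

/-- Two admissible subgroups are compared through their intersection, so the arbitrary choice in
`ev` is harmless. -/
theorem ev_eq {U : Subgroup G} (hU : IsCompactOpen U) (t : equivariantEnd k G) {φ : G → V}
    (hφ : ∀ x, ∀ u ∈ U, φ (x * u) = φ x) :
    ev t φ = Finsupp.linearCombination k (fun q : G ⧸ U => φ q.out) (coeffs hU t) := by
  have h : ∃ U : Subgroup G, IsCompactOpen U ∧ ∀ x, ∀ u ∈ U, φ (x * u) = φ x := ⟨U, hU, hφ⟩
  rw [ev, dif_pos h, linearCombination_coeffs_of_le (h.choose_spec.1.inf hU) h.choose_spec.1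
    inf_le_left t h.choose_spec.2, linearCombination_coeffs_of_le (h.choose_spec.1.inf hU) hU
    inf_le_right t hφ]

/-- The linear map `ev`, as a function of both arguments. -/
noncomputable def evHom (V : Type*) [AddCommGroup V] [Module k V] :
    equivariantEnd k G →ₗ[k] unifFun k G V →ₗ[k] V :=
  LinearMap.mk₂ k (fun t φ => ev t φ.1)
    (fun t t' φ => by
      obtain ⟨U, hU, h⟩ := exists_isCompactOpen_invariant φ.2
      rw [ev_eq hU _ h, ev_eq hU _ h, ev_eq hU _ h, coeffs_add, map_add])
    (fun c t φ => by
      obtain ⟨U, hU, h⟩ := exists_isCompactOpen_invariant φ.2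
      rw [ev_eq hU _ h, ev_eq hU _ h, coeffs_smul, map_smul])
    (fun t φ ψ => by
      obtain ⟨U, hU, h⟩ := exists_isCompactOpen_invariant (φ := fun x => (φ.1 x, ψ.1 x))
        (by filter_upwards [φ.2, ψ.2] with u h1 h2 x using by rw [h1, h2])
      have h1 : ∀ x, ∀ u ∈ U, φ.1 (x * u) = φ.1 x := fun x u hu => congrArg Prod.fst (h x u hu)
      have h2 : ∀ x, ∀ u ∈ U, ψ.1 (x * u) = ψ.1 x := fun x u hu => congrArg Prod.snd (h x u hu)
      rw [ev_eq hU _ h1, ev_eq hU _ h2, ev_eq hU (φ := (φ + ψ).1) _ fun x u hu => by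
        change φ.1 _ + ψ.1 _ = φ.1 _ + ψ.1 _
        rw [h1 x u hu, h2 x u hu]]
      simp only [Finsupp.linearCombination_apply, Finsupp.sum, ← Finset.sum_add_distrib]
      exact Finset.sum_congr rfl fun q _ => smul_add _ _ _)
    (fun c t φ => by
      obtain ⟨U, hU, h⟩ := exists_isCompactOpen_invariant φ.2
      rw [ev_eq hU _ h, ev_eq hU (φ := (c • φ).1) _ fun x u hu => by
        change c • φ.1 _ = c • φ.1 _
        rw [h x u hu]]
      simp only [Finsupp.linearCombination_apply, Finsupp.sum, Finset.smul_sum]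
      exact Finset.sum_congr rfl fun q _ => smul_comm _ _ _)

theorem evHom_apply (t : equivariantEnd k G) (φ : unifFun k G V) : evHom V t φ = ev t φ.1 := rfl

theorem ev_comp {W : Type*} [AddCommGroup W] [Module k W] (F : V →ₗ[k] W)
    (t : equivariantEnd k G) {φ : G → V} (hφ : φ ∈ unifFun k G V) :
    ev t (fun x => F (φ x)) = F (ev t φ) := by
  obtain ⟨U, hU, h⟩ := exists_isCompactOpen_invariant hφ
  rw [ev_eq hU _ h, ev_eq hU _ fun x u hu => by rw [h x u hu]]
  simp [Finsupp.linearCombination_apply, Finsupp.sum, map_sum]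

theorem testFunctions_mem_unifFun (f : testFunctions k G) : f.1 ∈ unifFun k G k := by
  have h := eventually_leftTranslate_eq k G (f := fun x => f.1 x⁻¹)
    (f.2.1.comp_continuous continuous_inv) (f.2.2.comp_homeomorph (Homeomorph.inv G))
  filter_upwards [h] with u hu x
  simpa using hu x⁻¹

theorem eq_sum_cosetInd {U : Subgroup G} (hU : IsCompactOpen U) (f : testFunctions k G)
    (hf : ∀ x, ∀ u ∈ U, f.1 (x * u) = f.1 x) :
    f = ∑ q ∈ (hU.finite_cosets f.2.2).toFinset, f.1 q.out • cosetInd k hU q := by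
  classical
  refine Subtype.ext (funext fun x => ?_)
  rw [Submodule.coe_sum, Finset.sum_apply]
  simp only [Submodule.coe_smul, Pi.smul_apply, cosetInd_apply, smul_eq_mul, mul_ite, mul_one,
    mul_zero]
  rw [Finset.sum_ite_eq]
  have hx : f.1 (x : G ⧸ U).out = f.1 x := eq_of_mk_eq hf (QuotientGroup.out_eq' _)
  split_ifs with h
  · exact hx.symm
  · refine image_eq_zero_of_notMem_tsupport fun hx' => h ?_
    simpa using ⟨x, hx', rfl⟩

theorem ev_testFunctions (t : equivariantEnd k G) (f : testFunctions k G) :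
    ev t f.1 = (t.1 f).1 1 := by
  classical
  obtain ⟨U, hU, h⟩ := exists_isCompactOpen_invariant (testFunctions_mem_unifFun f)
  rw [ev_eq hU _ h]
  conv_rhs => rw [eq_sum_cosetInd hU f h]
  rw [map_sum, Submodule.coe_sum, Finset.sum_apply, Finsupp.linearCombination_apply]
  have : ∀ q : G ⧸ U, (t.1 (f.1 q.out • cosetInd k hU q)).1 1 = coeffs hU t q • f.1 q.out := by
    intro q
    rw [map_smul, coeffs_apply, smul_eq_mul, mul_comm]
    rfl
  simp_rw [this]
  -- The cosets charged by `t` and those meeting the support of f are unrelated finite sets; both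
  -- sums are extended to the union.
  rw [Finsupp.sum_of_support_subset _ (s := (coeffs hU t).support ∪
    (hU.finite_cosets f.2.2).toFinset) Finset.subset_union_left _ (by simp)]
  symm
  refine Finset.sum_subset Finset.subset_union_right fun q _ hq => ?_
  have hq' : q.out ∉ tsupport f.1 := fun hq' =>
    hq ((Set.Finite.mem_toFinset _).2 ⟨_, hq', QuotientGroup.out_eq' q⟩)
  rw [image_eq_zero_of_notMem_tsupport hq', smul_zero]

variable (k G) in
/-- The identity endomorphism of `k(G)`. -/
def equivariantId : equivariantEnd k G := ⟨LinearMap.id, fun _ _ => rfl⟩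

theorem ev_id {φ : G → V} (hφ : φ ∈ unifFun k G V) : ev (equivariantId k G) φ = φ 1 := by
  classical
  obtain ⟨U, hU, h⟩ := exists_isCompactOpen_invariant hφ
  have hc : coeffs hU (equivariantId k G) = Finsupp.single ((1 : G) : G ⧸ U) 1 := by
    ext q
    rw [coeffs_apply, Finsupp.single_apply]
    rfl
  rw [ev_eq hU _ h, hc, Finsupp.linearCombination_single, one_smul]
  exact eq_of_mk_eq h (QuotientGroup.out_eq' _)

/-- The coefficients of an endomorphism of `k(G)`, moved to representatives of the cosets. -/
noncomputable def outCoeffs {U : Subgroup G} (hU : IsCompactOpen U) (t : equivariantEnd k G) :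
    G →₀ k :=
  Finsupp.mapDomain Quotient.out (coeffs hU t)

theorem ev_eq_outCoeffs {U : Subgroup G} (hU : IsCompactOpen U) (t : equivariantEnd k G)
    {φ : G → V} (hφ : ∀ x, ∀ u ∈ U, φ (x * u) = φ x) :
    ev t φ = Finsupp.linearCombination k φ (outCoeffs hU t) := by
  rw [ev_eq hU _ hφ, outCoeffs, Finsupp.linearCombination_mapDomain]
  rfl

end Evaluation

end Uniform

/-! ### Endomorphisms of the forgetful functor of smooth modules -/

section SmoothEnd

variable {k : Type u} {G : Type v} [Field k] [Group G] [TopologicalSpace G]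
  [IsTopologicalGroup G]

variable (k G) in
/-- The morphism of smooth modules defined by an equivariant linear map. -/
def smoothHom {M N : SmoothRep.{u, v, w} k G} (f : M.obj.V →ₗ[k] N.obj.V)
    (hf : ∀ g x, f (M.obj.ρ g x) = N.obj.ρ g (f x)) : M ⟶ N :=
  ObjectProperty.homMk (Rep.ofHom ⟨f, fun g => LinearMap.ext (hf g)⟩)

theorem end_naturality (θ : End (smoothForget.{u, v, w} k G)) {M N : SmoothRep.{u, v, w} k G}
    (f : M ⟶ N) (x : M.obj.V) :
    (θ.app N).hom (((smoothForget k G).map f).hom x) =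
      ((smoothForget k G).map f).hom ((θ.app M).hom x) :=
  LinearMap.congr_fun (congrArg ModuleCat.Hom.hom (θ.naturality f)) x

theorem end_naturality_smoothHom (θ : End (smoothForget.{u, v, w} k G))
    {M N : SmoothRep.{u, v, w} k G} (f : M.obj.V →ₗ[k] N.obj.V)
    (hf : ∀ g x, f (M.obj.ρ g x) = N.obj.ρ g (f x)) (x : M.obj.V) :
    (θ.app N).hom (f x) = f ((θ.app M).hom x) :=
  end_naturality θ (smoothHom k G f hf) x

theorem orbit_mem_unifFun (N : SmoothRep.{u, v, w} k G) (n : N.obj.V) :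
    (fun g => N.obj.ρ g n) ∈ unifFun k G N.obj.V := by
  filter_upwards [(N.property n).mem_nhds (show N.obj.ρ 1 n = n by simp)] with u hu x
  rw [map_mul, Module.End.mul_apply, show N.obj.ρ u n = n from hu]

/-- The orbit function of a vector in a smooth module. -/
def orbitMap (N : SmoothRep.{u, v, w} k G) : N.obj.V →ₗ[k] unifFun k G N.obj.V where
  toFun n := ⟨fun g => N.obj.ρ g n, orbit_mem_unifFun N n⟩
  map_add' n n' := Subtype.ext (funext fun _ => map_add _ n n')
  map_smul' c n := Subtype.ext (funext fun _ => map_smul _ c n)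

/-- The permutation representation on the finitely supported functions on the cosets. -/
noncomputable def cosetRep (U : Subgroup G) : Representation k G (G ⧸ U →₀ k) where
  toFun g := Finsupp.lmapDomain k k (g • ·)
  map_one' := by ext; simp
  map_mul' g h := by ext; simp [mul_smul]

theorem isSmooth_cosetRep {U : Subgroup G} (hU : IsCompactOpen U) :
    IsSmooth k G (Rep.of (cosetRep (k := k) U)) := by
  intro a
  refine isOpen_stabilizer_of_eventually k G (cosetRep U) a ?_
  have h : ∀ q ∈ a.support, ∀ᶠ u in 𝓝 (1 : G), u • q = q := by
    intro q _
    obtain ⟨g, rfl⟩ := QuotientGroup.mk_surjective q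
    have ht : Filter.Tendsto (fun u : G => g⁻¹ * u⁻¹ * g) (𝓝 1) (𝓝 1) := by
      have : Continuous fun u : G => g⁻¹ * u⁻¹ * g := by fun_prop
      simpa using this.tendsto 1
    filter_upwards [ht (hU.isOpen.mem_nhds U.one_mem)] with u hu
    refine QuotientGroup.eq.2 ?_
    simpa [mul_assoc] using hu
  filter_upwards [(Filter.eventually_all_finset _).2 h] with u hu
  change Finsupp.mapDomain (u • ·) a = a
  conv_rhs => rw [← Finsupp.mapDomain_id (v := a)]
  exact Finsupp.mapDomain_congr hu

/-- The smooth module of finitely supported functions on the cosets. -/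
noncomputable abbrev cosetModule {U : Subgroup G} (hU : IsCompactOpen U) :
    SmoothRep.{u, v, max u v} k G :=
  ⟨Rep.of (cosetRep (k := k) U), isSmooth_cosetRep hU⟩

/-- The module k[G/U] represents U-invariants: naturality is applied to the morphism k[G/U] → N that
takes the trivial coset to n. -/
theorem end_app_of_invariant (θ : End (smoothForget.{u, v, max u v} k G)) {U : Subgroup G}
    (hU : IsCompactOpen U) (N : SmoothRep.{u, v, max u v} k G) (n : N.obj.V)
    (hn : ∀ u ∈ U, N.obj.ρ u n = n) :
    (θ.app N).hom n = Finsupp.linearCombination k (fun q : G ⧸ U => N.obj.ρ q.out n)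
      ((θ.app (cosetModule hU)).hom (Finsupp.single ((1 : G) : G ⧸ U) (1 : k))) := by
  have hinv : ∀ x, ∀ u ∈ U, N.obj.ρ (x * u) n = N.obj.ρ x n := fun x u hu => by
    rw [map_mul, Module.End.mul_apply, hn u hu]
  let F : (G ⧸ U →₀ k) →ₗ[k] N.obj.V :=
    Finsupp.linearCombination k (fun q : G ⧸ U => N.obj.ρ q.out n)
  have hF : ∀ g x, F (cosetRep U g x) = N.obj.ρ g (F x) := by
    intro g x
    change Finsupp.linearCombination k _ (Finsupp.mapDomain (g • ·) x) = _
    rw [Finsupp.linearCombination_mapDomain]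
    simp only [F, Finsupp.linearCombination_apply, map_finsuppSum, map_smul]
    refine Finsupp.sum_congr fun q _ => ?_
    congr 1
    rw [← Module.End.mul_apply, ← map_mul]
    refine eq_of_mk_eq (φ := fun x => N.obj.ρ x n) hinv ?_
    simp only [QuotientGroup.out_eq']
    conv_lhs => rw [← QuotientGroup.out_eq' q]
    rfl
  have := end_naturality_smoothHom θ (M := cosetModule hU) (N := N) F hF
    (Finsupp.single ((1 : G) : G ⧸ U) (1 : k))
  rw [← this]
  congr 1
  simp only [F, Finsupp.linearCombination_single, one_smul]
  have h1 := eq_of_mk_eq (φ := fun x => N.obj.ρ x n) hinv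
    (QuotientGroup.out_eq' ((1 : G) : G ⧸ U))
  simpa using h1.symm

/-- The endomorphism of `k(G)` by which an endomorphism of the forgetful functor acts in `k(G)`
with the action by right translations. -/
def equivariantOfEnd (θ : End (smoothForget.{u, v, max u v} k G)) : equivariantEnd k G :=
  -- Left translations commute with right ones, so they are endomorphisms of the smooth module S',
  -- and naturality applies.
  ⟨(θ.app (rightRegular k G)).hom, fun g f =>
    end_naturality_smoothHom θ (M := rightRegular k G) (N := rightRegular k G)
      (leftTranslation k G g) (fun h f => Subtype.ext (funext fun x => by
        change f.1 (g⁻¹ * x * h) = f.1 (g⁻¹ * (x * h))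
        rw [mul_assoc])) f⟩

/-- The vector 1_U of S' is U-fixed. If θ takes the trivial coset to a in k[G/U], then θ takes 1_U
to the sum of a(q) times the right translate of 1_U by a representative of q, and the value of this
sum at g⁻¹ is a(gU). Thus S' sees all of θ. -/
theorem coeffs_equivariantOfEnd (θ : End (smoothForget.{u, v, max u v} k G)) {U : Subgroup G}
    (hU : IsCompactOpen U) :
    coeffs hU (equivariantOfEnd θ) =
      (θ.app (cosetModule hU)).hom (Finsupp.single ((1 : G) : G ⧸ U) (1 : k)) := by
  classical
  ext q
  obtain ⟨g, rfl⟩ := QuotientGroup.mk_surjective q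
  have hg : ((g : G) : G ⧸ U) = g • ((1 : G) : G ⧸ U) := by
    change _ = ((g * 1 : G) : G ⧸ U)
    rw [mul_one]
  rw [coeffs_apply]
  conv_lhs => rw [hg, ← leftTranslation_cosetInd, ← inv_inv g, ← equivariantEnd_apply]
  have hn : ∀ u ∈ U, rightTranslation k G u (cosetInd k hU ((1 : G) : G ⧸ U)) =
      cosetInd k hU ((1 : G) : G ⧸ U) := fun u hu => Subtype.ext (funext fun x => by
    change (cosetInd k hU ((1 : G) : G ⧸ U)).1 (x * u) = _
    rw [cosetInd_apply, cosetInd_apply, QuotientGroup.mk_mul_of_mem x hu])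
  have h := end_app_of_invariant θ hU (rightRegular k G) (cosetInd k hU ((1 : G) : G ⧸ U)) hn
  change ((θ.app (rightRegular k G)).hom (cosetInd k hU ((1 : G) : G ⧸ U)) :
    testFunctions k G).1 g⁻¹ = _
  rw [h]
  generalize (θ.app (cosetModule hU)).hom (Finsupp.single ((1 : G) : G ⧸ U) (1 : k)) = a
  change G ⧸ U →₀ k at a
  have hterm : ∀ q : G ⧸ U, (cosetInd k hU ((1 : G) : G ⧸ U)).1 (g⁻¹ * q.out) =
      if (g : G ⧸ U) = q then 1 else 0 := by
    intro q
    rw [cosetInd_apply]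
    refine if_congr ?_ rfl rfl
    conv_rhs => rw [← QuotientGroup.out_eq' q]
    rw [QuotientGroup.eq, ← inv_mem_iff, QuotientGroup.eq]
    simp
  rw [Finsupp.linearCombination_apply, Finsupp.sum]
  change ((∑ q ∈ a.support, a q • rightTranslation k G q.out (cosetInd k hU ((1 : G) : G ⧸ U)) :
    testFunctions k G)).1 g⁻¹ = _
  rw [Submodule.coe_sum, Finset.sum_apply]
  change ∑ q ∈ a.support, a q • (cosetInd k hU ((1 : G) : G ⧸ U)).1 (g⁻¹ * q.out) = _
  simp_rw [hterm, smul_eq_mul, mul_ite, mul_one, mul_zero]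
  rw [Finset.sum_ite_eq]
  split_ifs with h
  · rfl
  · exact (Finsupp.notMem_support_iff.1 h).symm

variable [LocallyCompactSpace G] [TotallyDisconnectedSpace G] [T2Space G]

theorem end_app_apply (θ : End (smoothForget.{u, v, max u v} k G))
    (N : SmoothRep.{u, v, max u v} k G) (n : N.obj.V) :
    (θ.app N).hom n = ev (equivariantOfEnd θ) (fun g => N.obj.ρ g n) := by
  obtain ⟨U, hU, h⟩ := exists_isCompactOpen_invariant (φ := fun g => N.obj.ρ g n)
    (orbit_mem_unifFun N n)
  rw [ev_eq hU _ h, coeffs_equivariantOfEnd]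
  exact end_app_of_invariant θ hU N n fun u hu => by simpa using h 1 u hu

/-- The endomorphism of the forgetful functor defined by an endomorphism of `k(G)`. -/
noncomputable def smoothAct (t : equivariantEnd k G) : End (smoothForget.{u, v, w} k G) where
  app N := ModuleCat.ofHom (evHom N.obj.V t ∘ₗ orbitMap N)
  naturality M N f := by
    refine ModuleCat.hom_ext (LinearMap.ext fun n => ?_)
    change ev t (fun g => N.obj.ρ g (f.hom.hom n)) = f.hom.hom (ev t fun g => M.obj.ρ g n)
    rw [show f.hom.hom (ev t fun g => M.obj.ρ g n) = f.hom.hom.toLinearMap _ from rfl,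
      ← ev_comp f.hom.hom.toLinearMap t (orbit_mem_unifFun M n)]
    congr 1
    funext g
    exact (Rep.hom_comm_apply f.hom g n).symm

/-- Evaluated at x, the action of `t` on f in S' is the integral of g ↦ f(xg), the left translate of
f by x⁻¹; by `ev_testFunctions` and equivariance this is (t f)(x). -/
theorem equivariantOfEnd_smoothAct (t : equivariantEnd k G) :
    equivariantOfEnd (smoothAct t) = t := by
  refine Subtype.ext (LinearMap.ext fun f => Subtype.ext (funext fun x => ?_))
  change (ev t fun g => rightTranslation k G g f).1 x = _
  let F : testFunctions k G →ₗ[k] k := LinearMap.proj x ∘ₗ (testFunctions k G).subtype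
  change F (ev t fun g => rightTranslation k G g f) = _
  refine (ev_comp F t (orbit_mem_unifFun (rightRegular k G) f)).symm.trans ?_
  rw [equivariantEnd_apply, ← ev_testFunctions]
  congr 1
  funext g
  change f.1 (x * g) = f.1 (x⁻¹⁻¹ * g)
  rw [inv_inv]

theorem smoothAct_equivariantOfEnd (θ : End (smoothForget.{u, v, max u v} k G)) :
    smoothAct (equivariantOfEnd θ) = θ := by
  refine NatTrans.ext (funext fun N => ModuleCat.hom_ext (LinearMap.ext fun n => ?_))
  exact (end_app_apply θ N n).symm

/-- The equivalence between `End(k(G))` and the equivariant linear maps. -/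
def endLeftRegularEquiv : End (leftRegular k G) ≃ equivariantEnd k G where
  toFun f := ⟨f.hom.hom.toLinearMap, f.hom.hom.isIntertwining⟩
  invFun t := smoothHom k G (M := leftRegular k G) (N := leftRegular k G) t.1 t.2
  left_inv _ := rfl
  right_inv _ := rfl

variable (k G) in
/-- The algebra of endomorphisms of the forgetful functor is `End(k(G))`. -/
noncomputable def smoothEndEquiv :
    End (smoothForget.{u, v, max u v} k G) ≃ₐ[k] End (leftRegular k G) :=
  { toFun := fun θ => endLeftRegularEquiv.symm (equivariantOfEnd θ)
    invFun := fun f => smoothAct (endLeftRegularEquiv f)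
    left_inv := fun θ => smoothAct_equivariantOfEnd θ
    right_inv := fun f => 
      congrArg endLeftRegularEquiv.symm (equivariantOfEnd_smoothAct (endLeftRegularEquiv f))
    map_mul' := fun _ _ => rfl
    map_add' := fun _ _ => rfl
    commutes' := fun _ => rfl }

end SmoothEnd

/-! ### Measures defined by finitary functionals -/

section Finitary

variable (k : Type u) [Field k] {Y : Type*} {X : Type*} [TopologicalSpace X]
  {V : Type*} [AddCommGroup V] [Module k V]

/-- A functional on functions `Y → V` which, on the functions constant on the classes of any
equivalence relation from a given family, is a finite linear combination of values at points
of `Z`. -/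
structure IsFinitary (Z : Set Y) (D : Setoid Y → Prop) (J : (Y → V) → V) : Prop where
  inf : ∀ r r', D r → D r' → D (r ⊓ r')
  exists_sum : ∀ r, D r → ∃ c : Y →₀ k, (∀ y ∈ c.support, y ∈ Z) ∧
    ∀ H : Y → V, (∀ y y', r y y' → H y = H y') → J H = Finsupp.linearCombination k H c

open Classical in
/-- The measure `C ↦ J(1_{w ∈ C} H)`. -/
noncomputable def IsFinitary.meas {Z : Set Y} {D : Setoid Y → Prop} {J : (Y → V) → V}
    (hJ : IsFinitary k Z D J) (w : Y → X) (H : Y → V) {K : Set X} (hK : IsCompact K)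
    (hwK : ∀ y ∈ Z, w y ∈ K)
    (hw : ∀ C : Clopens X, ∃ r, D r ∧ ∀ y y', r y y' → (w y ∈ C ↔ w y' ∈ C) ∧ H y = H y') :
    Meas k X V :=
  ⟨fun C => J fun y => if w y ∈ C then H y else 0, by
    constructor
    · intro A B hAB
      obtain ⟨r, hr, h⟩ := hw A
      obtain ⟨r', hr', h'⟩ := hw B
      -- The common refinement of the two relations lets one finite combination of point values
      -- compute J on all three functions, reducing additivity to a pointwise identity.
      obtain ⟨c, -, hc⟩ := hJ.exists_sum _ (hJ.inf r r' hr hr')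
      have hu : ∀ x, x ∈ A ⊔ B ↔ x ∈ A ∨ x ∈ B := fun x => Iff.rfl
      dsimp only
      rw [hc, hc, hc]
      · simp only [Finsupp.linearCombination_apply, Finsupp.sum, ← Finset.sum_add_distrib,
          ← smul_add]
        refine Finset.sum_congr rfl fun y _ => ?_
        have hd : ¬ (w y ∈ A ∧ w y ∈ B) := by
          rintro ⟨ha, hb⟩
          have : w y ∈ A ⊓ B := ⟨ha, hb⟩
          rw [hAB.eq_bot] at this
          exact this
        congr 1
        by_cases ha : w y ∈ A <;> by_cases hb : w y ∈ B <;> simp_all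
      · intro y y' hy
        simp only [(h' y y' hy.2).1, (h' y y' hy.2).2]
      · intro y y' hy
        simp only [(h y y' hy.1).1, (h y y' hy.1).2]
      · intro y y' hy
        simp only [hu, (h y y' hy.1).1, (h y y' hy.1).2, (h' y y' hy.2).1]
    · refine ⟨K, hK, fun A hA => ?_⟩
      obtain ⟨r, hr, h⟩ := hw A
      obtain ⟨c, hcZ, hc⟩ := hJ.exists_sum r hr
      dsimp only
      rw [hc _ fun y y' hy => by simp only [(h y y' hy).1, (h y y' hy).2],
        Finsupp.linearCombination_apply]
      refine Finset.sum_eq_zero fun y hy => ?_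
      dsimp only
      have hyA : w y ∉ A := fun hyA => Set.disjoint_left.1 hA hyA (hwK y (hcZ y hy))
      rw [if_neg hyA, smul_zero]⟩

end Finitary

section RightAction

variable {k : Type u} {G : Type v} [Field k] [Group G] [TopologicalSpace G]
  [IsTopologicalGroup G]

open Classical in
theorem pointMeas_apply {X : Type*} [TopologicalSpace X] {V : Type*} [AddCommGroup V] [Module k V]
    (x : X) (a : V) (A : Clopens X) :
    (pointMeas k V x a).1 A = if x ∈ A then a else 0 := rfl

/-- The right action of `G` on a contramodule. -/
noncomputable def Contra.ract (P : Contra.{u, v, w} k G) (g : G) : P.carrier →ₗ[k] P.carrier where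
  toFun p := P.act (pointMeas k P.carrier g p)
  map_add' p q := by
    classical
    rw [← map_add]
    refine congrArg _ (Subtype.ext (funext fun A => ?_))
    change (pointMeas k P.carrier g (p + q)).1 A =
      (pointMeas k P.carrier g p).1 A + (pointMeas k P.carrier g q).1 A
    simp only [pointMeas_apply]
    split_ifs <;> simp
  map_smul' c p := by
    classical
    rw [RingHom.id_apply, ← map_smul]
    refine congrArg _ (Subtype.ext (funext fun A => ?_))
    change (pointMeas k P.carrier g (c • p)).1 A = c • (pointMeas k P.carrier g p).1 A
    simp only [pointMeas_apply]
    split_ifs <;> simp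

theorem Contra.ract_one (P : Contra.{u, v, w} k G) (p : P.carrier) : P.ract 1 p = p :=
  P.contraunit p

theorem Contra.ract_mul (P : Contra.{u, v, w} k G) (g h : G) (p : P.carrier) :
    P.ract (g * h) p = P.ract h (P.ract g p) := by
  classical
  have key := P.contraassoc (pointMeas k P.carrier (g, h) p)
  refine Eq.trans (congrArg P.act ?_) (key.trans (congrArg P.act ?_))
  · refine Subtype.ext (funext fun A => ?_)
    rfl
  · refine Subtype.ext (funext fun B => ?_)
    change P.act _ = (pointMeas k P.carrier h (P.ract g p)).1 B
    rw [pointMeas_apply]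
    split_ifs with hB
    · refine congrArg P.act (Subtype.ext (funext fun A => ?_))
      change (pointMeas k P.carrier (g, h) p).1 (A ×ˢ B) = (pointMeas k P.carrier g p).1 A
      rw [pointMeas_apply, pointMeas_apply]
      refine if_congr ?_ rfl rfl
      exact ⟨fun hm => hm.1, fun hm => ⟨hm, hB⟩⟩
    · rw [← map_zero P.act]
      refine congrArg P.act (Subtype.ext (funext fun A => ?_))
      change (pointMeas k P.carrier (g, h) p).1 (A ×ˢ B) = 0
      rw [pointMeas_apply, if_neg]
      exact fun hm => hB hm.2

theorem Contra.Hom.map_ract {P Q : Contra.{u, v, w} k G} (f : Contra.Hom P Q) (g : G)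
    (p : P.carrier) : f.lin (P.ract g p) = Q.ract g (f.lin p) := by
  classical
  refine (f.comm _).trans (congrArg Q.act (Subtype.ext (funext fun A => ?_)))
  change f.lin ((pointMeas k P.carrier g p).1 A) = (pointMeas k Q.carrier g (f.lin p)).1 A
  simp only [pointMeas_apply]
  split_ifs <;> simp

/-- A contraaction sees only the products `s w` in an integral of `1_{w ∈ C} (p s)`. -/
theorem Contra.act_eq_of_mul_eq (P : Contra.{u, v, w} k G) {Y : Type*} {Z : Set Y}
    {D : Setoid Y → Prop} {J : (Y → P.carrier) → P.carrier} (hJ : IsFinitary k Z D J)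
    {s s' w w' : Y → G} (hsw : ∀ y, s y * w y = s' y * w' y) {K : Set (G × G)}
    (hK : IsCompact K) (hvK : ∀ y ∈ Z, ((s' y)⁻¹ * s y, w y) ∈ K)
    (hE : ∀ E : Clopens (G × G), ∃ r, D r ∧ ∀ y y', r y y' →
      (((s' y)⁻¹ * s y, w y) ∈ E ↔ ((s' y')⁻¹ * s y', w y') ∈ E) ∧ s y = s y' ∧ s' y = s' y')
    (p : P.carrier) {ν ν' : Meas k G P.carrier}
    (hν : ∀ C, ν.1 C = J (by classical exact fun y => if w y ∈ C then P.ract (s y) p else 0))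
    (hν' : ∀ C, ν'.1 C =
      J (by classical exact fun y => if w' y ∈ C then P.ract (s' y) p else 0)) :
    P.act ν = P.act ν' := by
  classical
  -- Contraassociativity is applied to the measure carried by the points (s'⁻¹s, w) with values
  -- p·s'. Multiplying the coordinates gives s'⁻¹sw = w', hence ν'; contracting the first coordinate
  -- gives (p·s')·(s'⁻¹s) = p·s at w, hence ν.
  let Λ : Meas k (G × G) P.carrier :=
    hJ.meas k (fun y => ((s' y)⁻¹ * s y, w y)) (fun y => P.ract (s' y) p) hK hvK fun E => by
      obtain ⟨r, hr, h⟩ := hE E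
      exact ⟨r, hr, fun y y' hy => ⟨(h y y' hy).1, by rw [(h y y' hy).2.2]⟩⟩
  have h1 : pushforward k P.carrier
      (continuous_mul : Continuous fun p : G × G => p.1 * p.2) Λ = ν' := by
    refine Subtype.ext (funext fun C => ?_)
    rw [hν']
    change J _ = J _
    congr 1
    funext y
    refine if_congr ?_ rfl rfl
    change (s' y)⁻¹ * s y * w y ∈ C ↔ _
    rw [mul_assoc, hsw, inv_mul_cancel_left]
  have h2 : mapValues k P.act (curryMeas k Λ) = ν := by
    refine Subtype.ext (funext fun B => ?_)
    rw [hν]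
    -- This relation fixes s, s' and membership of w in B, but does not involve A; so one
    -- combination c works for all A and exhibits the inner measure as a finite sum of point
    -- measures.
    obtain ⟨r, hr, h⟩ := hE (⊤ ×ˢ B)
    obtain ⟨c, -, hc⟩ := hJ.exists_sum r hr
    have hB : ∀ y y', r y y' → (w y ∈ B ↔ w y' ∈ B) := fun y y' hy =>
      ⟨fun hm => ((h y y' hy).1.1 ⟨trivial, hm⟩).2, fun hm => ((h y y' hy).1.2 ⟨trivial, hm⟩).2⟩
    have h3 : (curryMeas k Λ).1 B = Finsupp.linearCombination k (fun y =>
        pointMeas k P.carrier ((s' y)⁻¹ * s y) (if w y ∈ B then P.ract (s' y) p else 0)) c := by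
      refine Subtype.ext (funext fun A => ?_)
      change J (fun y => if ((s' y)⁻¹ * s y, w y) ∈ A ×ˢ B then P.ract (s' y) p else 0) = _
      rw [hc]
      · rw [Finsupp.linearCombination_apply, Finsupp.linearCombination_apply, Finsupp.sum,
          Finsupp.sum, Submodule.coe_sum, Finset.sum_apply]
        refine Finset.sum_congr rfl fun y _ => ?_
        change _ = c y • (pointMeas k P.carrier ((s' y)⁻¹ * s y) _).1 A
        rw [pointMeas_apply, ← ite_and]
        exact congrArg _ (if_congr Iff.rfl rfl rfl)
      · intro y y' hy
        have hm : ((s' y)⁻¹ * s y, w y) ∈ A ×ˢ B ↔ ((s' y')⁻¹ * s y', w y') ∈ A ×ˢ B := by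
          rw [(h y y' hy).2.1, (h y y' hy).2.2]
          exact and_congr Iff.rfl (hB y y' hy)
        rw [if_congr hm rfl rfl, (h y y' hy).2.2]
    change P.act ((curryMeas k Λ).1 B) = _
    rw [h3, hc _ fun y y' hy => by rw [if_congr (hB y y' hy) rfl rfl, (h y y' hy).2.1],
      Finsupp.linearCombination_apply, Finsupp.linearCombination_apply, map_finsuppSum]
    refine Finsupp.sum_congr fun y _ => ?_
    rw [map_smul]
    congr 1
    change P.ract _ (ite _ _ _) = _
    split_ifs
    · rw [← P.ract_mul, mul_inv_cancel_left]
    · rw [map_zero]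
  rw [← h1, ← h2]
  exact (P.contraassoc Λ).symm

end RightAction

/-! ### The action of `End(k(G))` on contramodules -/

section ContraAct

/-- A tube lemma: it turns local constancy of membership in a clopen set into constancy uniform over
a compact parameter. -/
theorem eventually_mem_clopen_iff {A B X : Type*} [TopologicalSpace A] [TopologicalSpace B]
    [TopologicalSpace X] {F : A × B → X} (hF : Continuous F) (C : Clopens X) {K : Set B}
    (hK : IsCompact K) (a₀ : A) : ∀ᶠ a in 𝓝 a₀, ∀ b ∈ K, (F (a, b) ∈ C ↔ F (a₀, b) ∈ C) := by
  refine hK.eventually_forall_of_forall_eventually fun b _ => ?_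
  have hF' : Continuous fun z : A × B => F (a₀, z.2) := by fun_prop
  by_cases h : F (a₀, b) ∈ C
  · filter_upwards [(C.isClopen.isOpen.preimage hF).mem_nhds h,
      (C.isClopen.isOpen.preimage hF').mem_nhds (show F (a₀, (a₀, b).2) ∈ C from h)] with z h1 h2
    exact iff_of_true h1 h2
  · filter_upwards [(C.isClopen.compl.isOpen.preimage hF).mem_nhds h,
      (C.isClopen.compl.isOpen.preimage hF').mem_nhds
        (show F (a₀, (a₀, b).2) ∈ (C : Set X)ᶜ from h)] with z h1 h2
    exact iff_of_false h1 h2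

variable {k : Type u} {G : Type v} [Field k] [Group G] [TopologicalSpace G]
  [IsTopologicalGroup G]

/-- The equivalence relations on `G` coarser than the left coset relation of an open subgroup. -/
def UnifRel (r : Setoid G) : Prop := ∀ᶠ u in 𝓝 (1 : G), ∀ x, r (x * u) x

variable [LocallyCompactSpace G] [TotallyDisconnectedSpace G] [T2Space G]

theorem isFinitary_ev (t : equivariantEnd k G) (V : Type*) [AddCommGroup V] [Module k V] :
    IsFinitary k Set.univ (UnifRel (G := G)) (ev t : (G → V) → V) where
  inf r r' h h' := by
    filter_upwards [h, h'] with u hu hu' x using ⟨hu x, hu' x⟩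
  exists_sum r hr := by
    obtain ⟨U, hU, hUr⟩ := exists_isCompactOpen_subset hr
    exact ⟨outCoeffs hU t, fun _ _ => trivial, fun H hH =>
      ev_eq_outCoeffs hU t fun x u hu => hH _ _ (hUr hu x)⟩

variable (G) in
theorem exists_isCompactOpen : ∃ U : Subgroup G, IsCompactOpen U :=
  (exists_isCompactOpen_subset Filter.univ_mem).imp fun _ h => h.1

variable (G) in
/-- A compact open subgroup. -/
noncomputable def baseSubgroup : Subgroup G := (exists_isCompactOpen G).choose

variable (G) in
theorem isCompactOpen_baseSubgroup : IsCompactOpen (baseSubgroup G) :=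
  (exists_isCompactOpen G).choose_spec

/-- The representative of the coset of `x`. -/
noncomputable def cosetRepr (x : G) : G := (x : G ⧸ baseSubgroup G).out

/-- The component of `x` in the compact open subgroup. -/
noncomputable def cosetRem (x : G) : G := (cosetRepr x)⁻¹ * x

theorem cosetRepr_mul_cosetRem (x : G) : cosetRepr x * cosetRem x = x :=
  mul_inv_cancel_left _ _

theorem cosetRem_mem (x : G) : cosetRem x ∈ baseSubgroup G :=
  QuotientGroup.eq.1 (QuotientGroup.out_eq' (x : G ⧸ baseSubgroup G))

theorem cosetRepr_mul {u : G} (hu : u ∈ baseSubgroup G) (x : G) :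
    cosetRepr (x * u) = cosetRepr x := by
  rw [cosetRepr, QuotientGroup.mk_mul_of_mem x hu, cosetRepr]

theorem cosetRem_mul {u : G} (hu : u ∈ baseSubgroup G) (x : G) :
    cosetRem (x * u) = cosetRem x * u := by
  rw [cosetRem, cosetRepr_mul hu, ← mul_assoc, cosetRem]

theorem eventually_mem_baseSubgroup : ∀ᶠ u in 𝓝 (1 : G), u ∈ baseSubgroup G :=
  (isCompactOpen_baseSubgroup G).isOpen.mem_nhds (baseSubgroup G).one_mem

/-- The measure `C ↦ ∫ 1_{rem x ∈ C} (p repr x) dm(x)`. -/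
noncomputable def orbitMeas (t : equivariantEnd k G) (P : Contra.{u, v, w} k G) (p : P.carrier) :
    Meas k G P.carrier :=
  (isFinitary_ev t P.carrier).meas k cosetRem (fun x => P.ract (cosetRepr x) p)
    (isCompactOpen_baseSubgroup G).isCompact (fun x _ => cosetRem_mem x) fun C => by
      refine ⟨Setoid.ker fun x => (cosetRem x ∈ C, cosetRepr x), ?_, fun y y' hy => ?_⟩
      -- For small u, repr(xu) = repr(x) and rem(xu) = rem(x)u. Since rem(x) stays in a compact set,
      -- membership in C is unaffected by u uniformly in x.
      · filter_upwards [eventually_mem_baseSubgroup, eventually_mem_clopen_iff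
          (F := fun z : G × G => z.2 * z.1) (by fun_prop) C
          (isCompactOpen_baseSubgroup G).isCompact 1] with u hu hu' x
        refine Prod.ext (propext ?_) (cosetRepr_mul hu x)
        dsimp only
        rw [cosetRem_mul hu, hu' _ (cosetRem_mem x)]
        simp
      · have h1 := congrArg Prod.fst hy
        have h2 := congrArg Prod.snd hy
        exact ⟨iff_of_eq h1, congrArg (fun g => P.ract g p) h2⟩

open Classical in
theorem orbitMeas_apply (t : equivariantEnd k G) (P : Contra.{u, v, w} k G) (p : P.carrier)
    (C : Clopens G) : (orbitMeas t P p).1 C =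
      ev t fun x => if cosetRem x ∈ C then P.ract (cosetRepr x) p else 0 := rfl

open Classical in
theorem orbitFun_mem_unifFun (P : Contra.{u, v, w} k G) (p : P.carrier) (C : Clopens G) :
    (fun x => if cosetRem x ∈ C then P.ract (cosetRepr x) p else 0) ∈ unifFun k G P.carrier := by
  filter_upwards [eventually_mem_baseSubgroup, eventually_mem_clopen_iff
    (F := fun z : G × G => z.2 * z.1) (by fun_prop) C
    (isCompactOpen_baseSubgroup G).isCompact 1] with u hu hu' x
  rw [cosetRem_mul hu, cosetRepr_mul hu]
  refine if_congr ?_ rfl rfl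
  simpa using hu' _ (cosetRem_mem x)

/-- The action of `End(k(G))` on a contramodule. -/
noncomputable def contraEval (P : Contra.{u, v, w} k G) :
    equivariantEnd k G →ₗ[k] P.carrier →ₗ[k] P.carrier :=
  LinearMap.mk₂ k (fun t p => P.act (orbitMeas t P p))
    (fun t t' p => by
      rw [← map_add]
      refine congrArg _ (Subtype.ext (funext fun C => ?_))
      exact LinearMap.congr_fun (map_add (evHom P.carrier) t t') ⟨_, orbitFun_mem_unifFun P p C⟩)
    (fun c t p => by
      rw [← map_smul]
      refine congrArg _ (Subtype.ext (funext fun C => ?_))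
      exact LinearMap.congr_fun (map_smul (evHom P.carrier) c t) ⟨_, orbitFun_mem_unifFun P p C⟩)
    (fun t p p' => by
      classical
      rw [← map_add]
      refine congrArg _ (Subtype.ext (funext fun C => ?_))
      refine Eq.trans ?_ (map_add (evHom P.carrier t)
        ⟨_, orbitFun_mem_unifFun P p C⟩ ⟨_, orbitFun_mem_unifFun P p' C⟩)
      rw [orbitMeas_apply, evHom_apply]
      refine congrArg (ev t) (funext fun x => ?_)
      change (if cosetRem x ∈ C then P.ract (cosetRepr x) (p + p') else 0) =
        (if cosetRem x ∈ C then P.ract (cosetRepr x) p else 0) +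
          if cosetRem x ∈ C then P.ract (cosetRepr x) p' else 0
      split_ifs <;> simp)
    (fun c t p => by
      classical
      rw [← map_smul]
      refine congrArg _ (Subtype.ext (funext fun C => ?_))
      refine Eq.trans ?_ (map_smul (evHom P.carrier t) c ⟨_, orbitFun_mem_unifFun P p C⟩)
      rw [orbitMeas_apply, evHom_apply]
      refine congrArg (ev t) (funext fun x => ?_)
      change (if cosetRem x ∈ C then P.ract (cosetRepr x) (c • p) else 0) =
        c • if cosetRem x ∈ C then P.ract (cosetRepr x) p else 0
      split_ifs <;> simp)

theorem contraEval_apply (P : Contra.{u, v, w} k G) (t : equivariantEnd k G) (p : P.carrier) :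
    contraEval P t p = P.act (orbitMeas t P p) := rfl

theorem contraEval_naturality {P Q : Contra.{u, v, w} k G} (f : Contra.Hom P Q)
    (t : equivariantEnd k G) (p : P.carrier) :
    contraEval Q t (f.lin p) = f.lin (contraEval P t p) := by
  classical
  rw [contraEval_apply, contraEval_apply, f.comm]
  refine congrArg _ (Subtype.ext (funext fun C => ?_))
  refine Eq.trans ?_ (ev_comp f.lin t (orbitFun_mem_unifFun P p C))
  rw [orbitMeas_apply]
  refine congrArg (ev t) (funext fun x => ?_)
  split_ifs
  · rw [f.map_ract]
  · rw [map_zero]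

-- For the identity, m is the unit mass at 1, so the measure defining the action is a point measure
-- and the factors of 1 = repr(1) rem(1) recombine.
variable (k G) in
theorem contraEval_id (P : Contra.{u, v, w} k G) (p : P.carrier) :
    contraEval P (equivariantId k G) p = p := by
  classical
  have h : orbitMeas (equivariantId k G) P p =
      pointMeas k P.carrier (cosetRem 1) (P.ract (cosetRepr 1) p) :=
    Subtype.ext (funext fun C => ev_id (orbitFun_mem_unifFun P p C))
  rw [contraEval_apply, h]
  change P.ract _ (P.ract _ p) = p
  rw [← P.ract_mul, cosetRepr_mul_cosetRem, P.ract_one]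

/-- The endomorphism of the forgetful functor of contramodules defined by an endomorphism of
`k(G)`. -/
noncomputable def contraAct (t : equivariantEnd k G) : End (contraForget.{u, v, w} k G) where
  app P := ModuleCat.ofHom (contraEval P t)
  naturality _ _ f := ModuleCat.hom_ext (LinearMap.ext fun p => contraEval_naturality f t p)

theorem integral_pointMeas {X V W : Type*} [TopologicalSpace X] [AddCommGroup V] [Module k V]
    [AddCommGroup W] [Module k W] {h : X → W} (hh : IsLocallyConstant h) (x : X)
    (ξ : W →ₗ[k] V) : integral hh (pointMeas k _ x ξ) = ξ (h x) := by
  classical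
  rw [integral, finsum_eq_single _ (h x)]
  · rw [pointMeas_apply, if_pos]
    exact rfl
  · intro m hm
    rw [pointMeas_apply, if_neg]
    · rfl
    · exact fun hx => hm (Eq.symm hx)

theorem homContra_ract (N : SmoothRep.{u, v, w} k G) (V : ModuleCat.{w} k) (g : G)
    (ξ : N.obj.V →ₗ[k] V) : (homContra N V).ract g ξ = ξ ∘ₗ N.obj.ρ g :=
  LinearMap.ext fun n => integral_pointMeas (orbit_isLocallyConstant N n) g ξ

/-- In Hom(N, V) the functional ξ·repr(x) evaluated at rem(x)n is ξ(xn). Both sides thus become the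
same finite sum over representatives of cosets. -/
theorem contraEval_homContra (t : equivariantEnd k G) (N : SmoothRep.{u, v, w} k G)
    (V : ModuleCat.{w} k) (ξ : N.obj.V →ₗ[k] V) :
    contraEval (homContra N V) t ξ = ξ ∘ₗ ((smoothAct t).app N).hom := by
  classical
  refine LinearMap.ext fun n => ?_
  let ν : Meas k G (N.obj.V →ₗ[k] V) := orbitMeas t (homContra N V) ξ
  have hν : ∀ C, ν.1 C =
      ev t fun x => if cosetRem x ∈ C then ξ ∘ₗ N.obj.ρ (cosetRepr x) else 0 := fun C => by
    refine (orbitMeas_apply t (homContra N V) ξ C).trans ?_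
    simp_rw [homContra_ract]
    rfl
  change integral (orbit_isLocallyConstant N n) ν = ξ (ev t fun g => N.obj.ρ g n)
  -- U is chosen to preserve both xn and repr(x); then rem(x)n = repr(x)⁻¹(xn) is preserved too, and
  -- every integrand below is computed by the same coefficients.
  obtain ⟨U, hU, hUn⟩ := exists_isCompactOpen_invariant
    (φ := fun x => (N.obj.ρ x n, cosetRepr x)) (by
      filter_upwards [orbit_mem_unifFun N n, eventually_mem_baseSubgroup] with u hu hu' x
      rw [hu x, cosetRepr_mul hu'])
  have h1 : ∀ x, ∀ u ∈ U, N.obj.ρ (x * u) n = N.obj.ρ x n := fun x u hu =>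
    congrArg Prod.fst (hUn x u hu)
  have h2 : ∀ x, ∀ u ∈ U, cosetRepr (x * u) = cosetRepr x := fun x u hu =>
    congrArg Prod.snd (hUn x u hu)
  have h3 : ∀ x, N.obj.ρ (cosetRem x) n = N.obj.ρ (cosetRepr x)⁻¹ (N.obj.ρ x n) := fun x => by
    rw [cosetRem, map_mul, Module.End.mul_apply]
  have hval : ∀ m, ν.1 (lcPreimage (orbit_isLocallyConstant N n) {m}) m =
      ∑ x ∈ (outCoeffs hU t).support,
        if m = N.obj.ρ (cosetRem x) n then outCoeffs hU t x • ξ (N.obj.ρ x n) else 0 := by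
    intro m
    have hm : ∀ x, cosetRem x ∈ lcPreimage (orbit_isLocallyConstant N n) {m} ↔
        m = N.obj.ρ (cosetRem x) n := fun x => eq_comm
    rw [hν, ev_eq_outCoeffs hU, Finsupp.linearCombination_apply, Finsupp.sum]
    · rw [LinearMap.sum_apply]
      refine Finset.sum_congr rfl fun x _ => ?_
      rw [if_congr (hm x) rfl rfl]
      split_ifs with hx
      · rw [LinearMap.smul_apply, LinearMap.comp_apply, hx,
          ← Module.End.mul_apply, ← map_mul, cosetRepr_mul_cosetRem]
      · rw [smul_zero]; rfl
    · intro x u hu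
      have he : cosetRem (x * u) ∈ lcPreimage (orbit_isLocallyConstant N n) {m} ↔
          cosetRem x ∈ lcPreimage (orbit_isLocallyConstant N n) {m} := by
        rw [hm, hm, h3, h3, h1 x u hu, h2 x u hu]
      rw [if_congr he rfl rfl, h2 x u hu]
  rw [integral, finsum_congr hval, finsum_sum_comm, ← ev_comp ξ t (orbit_mem_unifFun N n),
    ev_eq_outCoeffs hU t fun x u hu => by rw [h1 x u hu], Finsupp.linearCombination_apply,
    Finsupp.sum]
  · refine Finset.sum_congr rfl fun x _ => ?_
    rw [finsum_eq_single _ (N.obj.ρ (cosetRem x) n) fun m hm => if_neg hm, if_pos rfl]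
  · intro x _
    refine (Set.finite_singleton (N.obj.ρ (cosetRem x) n)).subset fun m hm => ?_
    by_contra hne
    exact hm (if_neg hne)

end ContraAct

/-! ### `End(k(G))` as a contramodule -/

section FreeContra

variable {k : Type u} {G : Type v} [Field k] [Group G] [TopologicalSpace G]

theorem integral_congr {X V W : Type*} [TopologicalSpace X] [AddCommGroup V] [Module k V]
    [AddCommGroup W] [Module k W] {h h' : X → W} (hh : IsLocallyConstant h)
    (hh' : IsLocallyConstant h') (e : h = h') (μ : Meas k X (W →ₗ[k] V)) :
    integral hh μ = integral hh' μ := by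
  subst e
  rfl

theorem map_integral {X V V' W : Type*} [TopologicalSpace X] [AddCommGroup V] [Module k V]
    [AddCommGroup V'] [Module k V'] [AddCommGroup W] [Module k W] {h : X → W}
    (hh : IsLocallyConstant h) (F : V →ₗ[k] V') (μ : Meas k X (W →ₗ[k] V)) :
    F (integral hh μ) = ∑ᶠ m, F (μ.1 (lcPreimage hh {m}) m) :=
  F.toAddMonoidHom.map_finsum (finite_support_eval hh id μ)

variable [IsTopologicalGroup G] [LocallyCompactSpace G] [TotallyDisconnectedSpace G] [T2Space G]

/-- The action of `End(k(G))` on a smooth module. -/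
noncomputable def actMap (N : SmoothRep.{u, v, w} k G) :
    equivariantEnd k G →ₗ[k] N.obj.V →ₗ[k] N.obj.V :=
  LinearMap.lcomp k N.obj.V (orbitMap N) ∘ₗ evHom N.obj.V

theorem actMap_naturality {M N : SmoothRep.{u, v, w} k G} (f : M ⟶ N) (t : equivariantEnd k G)
    (m : M.obj.V) : f.hom.hom (actMap M t m) = actMap N t (f.hom.hom m) :=
  (end_naturality (smoothAct t) f m).symm

theorem actMap_rightRegular (t : equivariantEnd k G) : actMap (rightRegular k G) t = t.1 :=
  congrArg Subtype.val (equivariantOfEnd_smoothAct t)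

/-- The natural endomorphism `n ↦ ∫ dμ_g (g n)` of smooth modules. -/
noncomputable def smoothInt (μ : Meas k G (equivariantEnd k G)) :
    End (smoothForget.{u, v, w} k G) where
  app N := ModuleCat.ofHom (homAct N (ModuleCat.of k N.obj.V) (mapValues k (actMap N) μ))
  naturality M N f := by
    refine ModuleCat.hom_ext (LinearMap.ext fun m => ?_)
    let F : M.obj.V →ₗ[k] N.obj.V := f.hom.hom.toLinearMap
    have he : (fun g => N.obj.ρ g (F m)) = fun g => F (M.obj.ρ g m) :=
      funext fun g => (Rep.hom_comm_apply f.hom g m).symm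
    change integral (orbit_isLocallyConstant N (F m)) (mapValues k (actMap N) μ) =
      F (integral (orbit_isLocallyConstant M m) (mapValues k (actMap M) μ))
    have hF : IsLocallyConstant fun g => F (M.obj.ρ g m) :=
      (orbit_isLocallyConstant M m).comp F
    rw [integral_congr _ hF he, map_integral,
      show integral hF _ = _ from integral_comp (orbit_isLocallyConstant M m) F hF _]
    exact finsum_congr fun i => (actMap_naturality f _ i).symm

variable (k G) in
/-- The contramodule `End(k(G))`, a subcontramodule of `Hom(k(G), k(G))`. -/
noncomputable def equivariantContra : Contra.{u, v, max u v} k G where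
  carrier := equivariantEnd k G
  act :=
    { toFun := fun μ => equivariantOfEnd (smoothInt μ)
      map_add' := fun μ ν => Subtype.ext (map_add
        (homAct (rightRegular k G) (ModuleCat.of k (testFunctions k G)) ∘ₗ
          mapValues k (actMap (rightRegular k G))) μ ν)
      map_smul' := fun c μ => Subtype.ext (map_smul
        (homAct (rightRegular k G) (ModuleCat.of k (testFunctions k G)) ∘ₗ
          mapValues k (actMap (rightRegular k G))) c μ) }
  -- Both axioms are inherited from Hom(S', S'). The contraaction stays inside End(k(G)) because the
  -- integral is natural in the smooth module.
  contraassoc μ := Subtype.ext (by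
    refine ((homContra (rightRegular k G) (ModuleCat.of k (testFunctions k G))).contraassoc
      (mapValues k (actMap (rightRegular k G)) μ)).trans ?_
    refine congrArg (homAct (rightRegular k G) (ModuleCat.of k (testFunctions k G)))
      (Subtype.ext (funext fun B => ?_))
    exact (actMap_rightRegular (equivariantOfEnd (smoothInt ((curryMeas k μ).1 B)))).symm)
  contraunit t := Subtype.ext (by
    classical
    refine Eq.trans ?_ (((homContra (rightRegular k G) (ModuleCat.of k (testFunctions k G))
      ).contraunit (actMap (rightRegular k G) t)).trans (actMap_rightRegular t))
    refine congrArg (homAct (rightRegular k G) (ModuleCat.of k (testFunctions k G)))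
      (Subtype.ext (funext fun B => ?_))
    change actMap (rightRegular k G) (if (1 : G) ∈ B then t else 0) =
      if (1 : G) ∈ B then actMap (rightRegular k G) t else 0
    split_ifs
    · rfl
    · exact map_zero _)

variable (k G) in
/-- The inclusion of `End(k(G))` into `Hom(k(G), k(G))`. -/
noncomputable def equivariantContraIncl : Contra.Hom (equivariantContra k G)
    (homContra (rightRegular k G) (ModuleCat.of k (testFunctions k G))) where
  lin := actMap (rightRegular k G)
  comm _ := actMap_rightRegular _

/-! ### Iterated integrals over `G × G` -/

/-- The functional `H ↦ ∫ dμ_b (H(-, b))`. -/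
noncomputable def pairInt (μ : Meas k G (equivariantEnd k G)) {V : Type*} [AddCommGroup V]
    [Module k V] (H : G × G → V) : V := by
  classical
  -- The functional is total, with value 0 unless H is uniformly locally constant in x and locally
  -- constant in b uniformly in x.
  exact if h : (∀ b, (fun x => H (x, b)) ∈ unifFun k G V) ∧
      IsLocallyConstant fun b x => H (x, b) then
    integral (h := fun b => (⟨fun x => H (x, b), h.1 b⟩ : unifFun k G V))
      (by
        rw [IsLocallyConstant.iff_eventually_eq]
        intro b
        filter_upwards [(IsLocallyConstant.iff_eventually_eq _).1 h.2 b] with b' hb'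
        exact Subtype.ext hb') (mapValues k (evHom V) μ)
  else 0

theorem pairInt_eq (μ : Meas k G (equivariantEnd k G)) {V : Type*} [AddCommGroup V]
    [Module k V] {ι : Type*} {q : G → ι} (hq : IsLocallyConstant q) (φ : ι → unifFun k G V)
    {H : G × G → V} (hH : ∀ b, (fun x => H (x, b)) = (φ (q b)).1) :
    pairInt μ H = ∑ᶠ i, ev (μ.1 (lcPreimage hq {i})) (φ i).1 := by
  have hH' : (fun b x => H (x, b)) = (fun i => (φ i).1) ∘ q := funext hH
  have h : (∀ b, (fun x => H (x, b)) ∈ unifFun k G V) ∧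
      IsLocallyConstant fun b x => H (x, b) :=
    ⟨fun b => by rw [hH]; exact (φ (q b)).2, by rw [hH']; exact hq.comp _⟩
  rw [pairInt, dif_pos h]
  refine (integral_congr _ (hq.comp φ) (funext fun b => Subtype.ext (hH b)) _).trans ?_
  exact integral_comp hq φ _ _

/-- The equivalence relations on `G × G` which are uniform in the first variable and locally
constant in the second one. -/
def PairRel (r : Setoid (G × G)) : Prop :=
  (∀ b, ∀ᶠ u in 𝓝 (1 : G), ∀ x, r (x * u, b) (x, b)) ∧
    ∀ b₀, ∀ᶠ b in 𝓝 b₀, ∀ x, r (x, b) (x, b₀)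

/-- On K the partition of `G` cut out by r at b takes finitely many values. Replacing each b by a
representative with the same value leaves a finite sum of integrals in x, each of them finite. -/
theorem isFinitary_pairInt (μ : Meas k G (equivariantEnd k G)) {K : Set G} (hK : IsCompact K)
    (hμ : ∀ A : Clopens G, Disjoint (A : Set G) K → μ.1 A = 0) (V : Type*) [AddCommGroup V]
    [Module k V] :
    IsFinitary k {y : G × G | y.2 ∈ K} PairRel (pairInt μ : (G × G → V) → V) where
  inf r r' h h' := by
    refine ⟨fun b => ?_, fun b₀ => ?_⟩
    · filter_upwards [h.1 b, h'.1 b] with u hu hu' x using ⟨hu x, hu' x⟩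
    · filter_upwards [h.2 b₀, h'.2 b₀] with b hb hb' x using ⟨hb x, hb' x⟩
  exists_sum r hr := by
    classical
    let q : G → G → Quotient r := fun b x => Quotient.mk r (x, b)
    have hq : IsLocallyConstant q := by
      rw [IsLocallyConstant.iff_eventually_eq]
      intro b
      filter_upwards [hr.2 b] with b' hb'
      exact funext fun x => Quotient.sound (hb' x)
    have hfin : (q '' K).Finite := by
      let _ : TopologicalSpace (G → Quotient r) := ⊥
      have : DiscreteTopology (G → Quotient r) := ⟨rfl⟩
      exact (hK.image hq.continuous).finite_of_discrete
    -- Representatives are taken in K when possible, so that the points of the sum lie over K. For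
    -- values that are never attained the choice 1 is a dummy.
    have hrep : ∀ i, ∃ b, ((∃ b', q b' = i) → q b = i) ∧ (i ∈ q '' K → b ∈ K) := by
      intro i
      by_cases hi : i ∈ q '' K
      · obtain ⟨b, hb, rfl⟩ := hi
        exact ⟨b, fun _ => rfl, fun _ => hb⟩
      · by_cases hi' : ∃ b', q b' = i
        · exact ⟨hi'.choose, fun _ => hi'.choose_spec, fun h => (hi h).elim⟩
        · exact ⟨1, fun h => (hi' h).elim, fun h => (hi h).elim⟩
    choose rep hrep hrepK using hrep
    choose U hU hUr using fun b => exists_isCompactOpen_subset (hr.1 b)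
    let c : (G → Quotient r) → G × G →₀ k := fun i =>
      Finsupp.mapDomain (fun x => (x, rep i)) (outCoeffs (hU (rep i)) (μ.1 (lcPreimage hq {i})))
    refine ⟨∑ i ∈ hfin.toFinset, c i, fun y hy => ?_, fun H hH => ?_⟩
    · obtain ⟨i, hi, hy⟩ := Finset.mem_biUnion.1 (Finsupp.support_finsetSum hy)
      obtain ⟨x, -, rfl⟩ := Finset.mem_image.1 (Finsupp.mapDomain_support hy)
      exact hrepK i (hfin.mem_toFinset.1 hi)
    · have hinv : ∀ b x, ∀ u ∈ U b, H (x * u, b) = H (x, b) := fun b x u hu =>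
        hH _ _ (hUr b hu x)
      have hmem : ∀ b, (fun x => H (x, b)) ∈ unifFun k G V := fun b =>
        eventually_of_isCompactOpen (φ := fun x => H (x, b)) (hU b) (hinv b)
      rw [pairInt_eq μ hq (fun i => ⟨fun x => H (x, rep i),
        hmem (rep i)⟩), map_sum]
      · rw [finsum_eq_sum_of_support_subset (s := hfin.toFinset)]
        · refine Finset.sum_congr rfl fun i _ => ?_
          rw [ev_eq_outCoeffs (hU (rep i)) _ (hinv (rep i)), Finsupp.linearCombination_mapDomain]
          rfl
        · intro i hi
          by_contra hiK
          have h0 : μ.1 (lcPreimage hq {i}) = 0 := hμ _ (Set.disjoint_left.2 fun b hb hbK =>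
            hiK (by simpa using ⟨b, hbK, hb⟩))
          refine hi ?_
          dsimp only
          rw [h0]
          exact LinearMap.congr_fun (map_zero (evHom V)) (⟨fun x => H (x, rep i),
            hmem (rep i)⟩ : unifFun k G V)
      · intro b
        funext x
        refine hH _ _ (Quotient.exact ?_)
        exact congrFun (hrep (q b) ⟨b, rfl⟩).symm x

open Classical in
theorem pairInt_indicator (μ : Meas k G (equivariantEnd k G)) {V : Type*} [AddCommGroup V]
    [Module k V] {φ : G → V} (hφ : φ ∈ unifFun k G V) (B : Clopens G) :
    pairInt μ (fun y => if y.2 ∈ B then φ y.1 else 0) = ev (μ.1 B) φ := by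
  have hq : IsLocallyConstant fun b => b ∈ B := by
    rw [IsLocallyConstant.iff_eventually_eq]
    intro b
    by_cases hb : b ∈ B
    · filter_upwards [B.isClopen.isOpen.mem_nhds hb] with b' hb'
      exact propext (iff_of_true hb' hb)
    · filter_upwards [B.isClopen.compl.isOpen.mem_nhds hb] with b' hb'
      exact propext (iff_of_false hb' hb)
  rw [pairInt_eq μ hq fun i => if i then ⟨φ, hφ⟩ else 0, finsum_eq_single _ True]
  · have hB : lcPreimage hq {True} = B := by
      refine SetLike.ext fun b => ?_
      change (b ∈ B) = True ↔ _
      rw [eq_iff_iff, iff_true]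
    rw [hB, if_pos trivial]
  · intro i hi
    have hi' : ¬ i := fun h => hi (eq_true h)
    rw [if_neg hi']
    exact map_zero (evHom V _)
  · intro b
    funext x
    dsimp only
    split_ifs <;> rfl

variable (k G) in
/-- Right translations on the uniformly locally constant functions. -/
def unifTranslation (V : Type w) [AddCommGroup V] [Module k V] :
    Representation k G (unifFun k G V) where
  toFun g :=
    { toFun := fun φ => ⟨fun x => φ.1 (x * g), by
        have ht : Filter.Tendsto (fun u : G => g⁻¹ * u * g) (𝓝 1) (𝓝 1) := by
          have : Continuous fun u : G => g⁻¹ * u * g := by fun_prop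
          simpa using this.tendsto 1
        filter_upwards [ht.eventually φ.2] with u hu x
        rw [← hu (x * g)]
        simp [mul_assoc]⟩
      map_add' := fun _ _ => rfl
      map_smul' := fun _ _ => rfl }
  map_one' := by
    ext φ x
    simp
  map_mul' g h := by
    ext φ x
    simp [mul_assoc]

variable (k G) in
/-- The smooth module of uniformly locally constant functions. -/
def unifModule (V : Type w) [AddCommGroup V] [Module k V] : SmoothRep.{u, v, max v w} k G :=
  ⟨Rep.of (unifTranslation k G V), fun φ =>
    isOpen_stabilizer_of_eventually k G (unifTranslation k G V) φ (by
      filter_upwards [φ.2] with u hu using Subtype.ext (funext hu))⟩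

/-- A Fubini-type formula: φ is viewed as a vector of the smooth module of uniformly locally
constant functions, where `smoothInt` is known to act through `ev`, and the result is evaluated at
1. -/
theorem ev_smoothInt (μ : Meas k G (equivariantEnd k G)) {V : Type (max u v)} [AddCommGroup V]
    [Module k V] {φ : G → V} (hφ : φ ∈ unifFun k G V) :
    ev (equivariantOfEnd (smoothInt μ)) φ = pairInt μ fun y => φ (y.1 * y.2) := by
  let N : SmoothRep.{u, v, max u v} k G := unifModule k G V
  let n : unifFun k G V := ⟨φ, hφ⟩
  let F : unifFun k G V →ₗ[k] V := LinearMap.proj 1 ∘ₗ (unifFun k G V).subtype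
  have hev : ∀ (t : equivariantEnd k G) (ψ : unifFun k G V),
      F (ev t fun g => unifTranslation k G V g ψ) = ev t ψ.1 := by
    intro t ψ
    refine (ev_comp F t (orbit_mem_unifFun N ψ)).symm.trans (congrArg (ev t) (funext fun g => ?_))
    change ψ.1 (1 * g) = ψ.1 g
    rw [one_mul]
  have h1 := congrArg F (end_app_apply (smoothInt μ) N n)
  rw [pairInt_eq μ (orbit_isLocallyConstant N n) (id : unifFun k G V → unifFun k G V)
    fun b => rfl]
  refine (hev _ n).symm.trans (h1.symm.trans ?_)
  refine (map_integral (orbit_isLocallyConstant N n) F (mapValues k (actMap N) μ)).trans ?_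
  exact finsum_congr fun ψ => hev _ ψ

end FreeContra

/-! ### Endomorphisms of the forgetful functor of contramodules -/

section ContraEnd

variable {k : Type u} {G : Type v} [Field k] [Group G] [TopologicalSpace G]
  [IsTopologicalGroup G] [LocallyCompactSpace G] [TotallyDisconnectedSpace G] [T2Space G]

/-- The representatives range over an unbounded set, but for b in a compact set this form shows that
the quotient stays in a compact set. -/
theorem cosetRepr_inv_mul (x b : G) :
    (cosetRepr (x * b))⁻¹ * cosetRepr x = cosetRem (x * b) * b⁻¹ * (cosetRem x)⁻¹ := by
  rw [cosetRem, cosetRem]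
  group

theorem cosetRepr_mul_mul {u : G} (b : G) (hu : b⁻¹ * u * b ∈ baseSubgroup G) (x : G) :
    cosetRepr (x * u * b) = cosetRepr (x * b) := by
  rw [← cosetRepr_mul hu (x * b)]
  congr 1
  group

/-- The map `t ↦ p t` commutes with the contraactions. -/
theorem contraEval_act (P : Contra.{u, v, max u v} k G) (μ : Meas k G (equivariantEnd k G))
    (p : P.carrier) :
    contraEval P (equivariantOfEnd (smoothInt μ)) p =
      P.act (mapValues k ((contraEval P).flip p) μ) := by
  classical
  obtain ⟨K, hK, hμ⟩ := μ.2.2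
  have hJ := isFinitary_pairInt μ hK hμ P.carrier
  have hU := (isCompactOpen_baseSubgroup G).isCompact
  have hconj : ∀ b : G, ∀ᶠ u in 𝓝 (1 : G), b⁻¹ * u * b ∈ baseSubgroup G := fun b => by
    have ht : Filter.Tendsto (fun u : G => b⁻¹ * u * b) (𝓝 1) (𝓝 1) := by
      have : Continuous fun u : G => b⁻¹ * u * b := by fun_prop
      simpa using this.tendsto 1
    exact ht.eventually eventually_mem_baseSubgroup
  have hnear : ∀ b₀ : G, ∀ᶠ b in 𝓝 b₀, b₀⁻¹ * b ∈ baseSubgroup G := fun b₀ => by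
    have ht : Filter.Tendsto (fun b : G => b₀⁻¹ * b) (𝓝 b₀) (𝓝 1) := by
      simpa using (continuous_const_mul b₀⁻¹).tendsto b₀
    exact ht.eventually eventually_mem_baseSubgroup
  -- Λ has the values p·repr(x) at the points (rem x, b). Contracting the first coordinate yields
  -- the right-hand side; by contraassociativity one may multiply instead, which leaves repr(x) and
  -- rem(x)b to be compared with repr(xb) and rem(xb).
  let Λ : Meas k (G × G) P.carrier :=
    hJ.meas k (fun y => (cosetRem y.1, y.2)) (fun y => P.ract (cosetRepr y.1) p)
      (hU.prod hK) (fun y hy => ⟨cosetRem_mem y.1, hy⟩) fun E => by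
        refine ⟨Setoid.ker fun y => ((cosetRem y.1, y.2) ∈ E, cosetRepr y.1),
          ⟨fun b => ?_, fun b₀ => ?_⟩, fun y y' hy => ?_⟩
        · filter_upwards [eventually_mem_baseSubgroup, eventually_mem_clopen_iff
            (F := fun z : G × G => (z.2 * z.1, b)) (by fun_prop) E hU 1] with u hu hu' x
          refine Prod.ext (propext ?_) (cosetRepr_mul hu x)
          dsimp only
          rw [cosetRem_mul hu, hu' _ (cosetRem_mem x), mul_one]
        · filter_upwards [eventually_mem_clopen_iff
            (F := fun z : G × G => (z.2, z.1)) (by fun_prop) E hU b₀] with b hb x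
          exact Prod.ext (propext (hb _ (cosetRem_mem x))) rfl
        · have h2 := congrArg Prod.snd hy
          exact ⟨iff_of_eq (congrArg Prod.fst hy), congrArg (fun g => P.ract g p) h2⟩
  have h1 : mapValues k ((contraEval P).flip p) μ = mapValues k P.act (curryMeas k Λ) := by
    refine Subtype.ext (funext fun B => ?_)
    change P.act (orbitMeas (μ.1 B) P p) = P.act ((curryMeas k Λ).1 B)
    refine congrArg P.act (Subtype.ext (funext fun C => ?_))
    rw [orbitMeas_apply, ← pairInt_indicator μ (orbitFun_mem_unifFun P p C) B]
    change _ = pairInt μ fun y : G × G =>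
      if (cosetRem y.1, y.2) ∈ C ×ˢ B then P.ract (cosetRepr y.1) p else 0
    refine congrArg (pairInt μ) (funext fun y => ?_)
    rw [← ite_and]
    exact if_congr and_comm rfl rfl
  rw [h1, ← P.contraassoc Λ, contraEval_apply]
  symm
  have hKc : IsCompact ((fun z : (G × G) × G => (z.1.1 * z.2⁻¹ * z.1.2⁻¹, z.1.2 * z.2)) ''
      (((baseSubgroup G : Set G) ×ˢ (baseSubgroup G : Set G)) ×ˢ K)) :=
    ((hU.prod hU).prod hK).image (by fun_prop)
  refine P.act_eq_of_mul_eq hJ (s := fun y => cosetRepr y.1)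
    (s' := fun y => cosetRepr (y.1 * y.2)) (w := fun y => cosetRem y.1 * y.2)
    (w' := fun y => cosetRem (y.1 * y.2)) (fun y => ?_) hKc (fun y hy => ?_) (fun E => ?_) p
    (fun C => rfl) fun C => ?_
  · rw [← mul_assoc, cosetRepr_mul_cosetRem, cosetRepr_mul_cosetRem]
  · refine ⟨((cosetRem (y.1 * y.2), cosetRem y.1), y.2),
      ⟨⟨cosetRem_mem _, cosetRem_mem _⟩, hy⟩, ?_⟩
    rw [cosetRepr_inv_mul]
  · refine ⟨Setoid.ker fun y => (((cosetRepr (y.1 * y.2))⁻¹ * cosetRepr y.1,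
      cosetRem y.1 * y.2) ∈ E, cosetRepr y.1, cosetRepr (y.1 * y.2)),
      ⟨fun b => ?_, fun b₀ => ?_⟩, fun y y' hy => ?_⟩
    -- Replacing x by xu replaces xb by xb(b⁻¹ub), so both u and its conjugate must lie in the base
    -- subgroup for the two representatives to be unchanged.
    · filter_upwards [eventually_mem_baseSubgroup, hconj b, eventually_mem_clopen_iff
        (F := fun z : G × (G × G) => (z.2.1 * b⁻¹ * z.2.2⁻¹, z.2.2 * z.1 * b)) (by fun_prop) E
        (hU.prod hU) 1] with u hu hub hE x
      have e1 := cosetRepr_mul hu x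
      have e2 := cosetRepr_mul_mul b hub x
      refine Prod.ext (propext ?_) (Prod.ext e1 e2)
      dsimp only
      rw [e1, e2, cosetRem_mul hu, cosetRepr_inv_mul]
      refine (hE (cosetRem (x * b), cosetRem x) ⟨cosetRem_mem _, cosetRem_mem _⟩).trans ?_
      dsimp only
      rw [mul_one]
    · filter_upwards [hnear b₀, eventually_mem_clopen_iff
        (F := fun z : G × (G × G) => (z.2.1 * b₀⁻¹ * z.2.2⁻¹, z.2.2 * z.1)) (by fun_prop) E
        (hU.prod hU) b₀] with b hb hE x
      have e2 : cosetRepr (x * b) = cosetRepr (x * b₀) := by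
        rw [← cosetRepr_mul hb (x * b₀)]
        congr 1
        group
      refine Prod.ext (propext ?_) (Prod.ext rfl e2)
      dsimp only
      rw [e2, cosetRepr_inv_mul]
      exact hE (cosetRem (x * b₀), cosetRem x) ⟨cosetRem_mem _, cosetRem_mem _⟩
    · have h2 := congrArg Prod.snd hy
      exact ⟨iff_of_eq (congrArg Prod.fst hy), congrArg Prod.fst h2, congrArg Prod.snd h2⟩
  · rw [orbitMeas_apply, ev_smoothInt μ (orbitFun_mem_unifFun P p C)]

/-- The morphism of contramodules `End(k(G)) → P` defined by a vector of `P`. -/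
noncomputable def contraEvalHom (P : Contra.{u, v, max u v} k G) (p : P.carrier) :
    Contra.Hom (equivariantContra k G) P where
  lin := (contraEval P).flip p
  comm μ := contraEval_act P μ p

theorem contraEnd_naturality (η : End (contraForget.{u, v, w} k G)) {P Q : Contra.{u, v, w} k G}
    (f : Contra.Hom P Q) (p : P.carrier) :
    (η.app Q).hom (f.lin p) = f.lin ((η.app P).hom p) :=
  LinearMap.congr_fun (congrArg ModuleCat.Hom.hom (η.naturality (X := P) (Y := Q) f)) p

/-- The morphism of contramodules `Hom(N, V) → Hom(N, W)` defined by a linear map `V → W`. -/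
def homContraMap (N : SmoothRep.{u, v, w} k G) {V W : ModuleCat.{w} k} (F : V →ₗ[k] W) :
    Contra.Hom (homContra N V) (homContra N W) where
  lin := LinearMap.compRight k F
  comm μ := LinearMap.ext fun n => map_integral (orbit_isLocallyConstant N n) F μ

/-- The morphism of contramodules `Hom(N, V) → Hom(M, V)` defined by a morphism `M → N`. -/
def homContraComap {M N : SmoothRep.{u, v, w} k G} (f : M ⟶ N) (V : ModuleCat.{w} k) :
    Contra.Hom (homContra N V) (homContra M V) where
  lin := LinearMap.lcomp k V f.hom.hom.toLinearMap
  comm μ := LinearMap.ext fun m => by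
    let F : M.obj.V →ₗ[k] N.obj.V := f.hom.hom.toLinearMap
    have he : (fun g => N.obj.ρ g (F m)) = fun g => F (M.obj.ρ g m) :=
      funext fun g => (Rep.hom_comm_apply f.hom g m).symm
    have hF : IsLocallyConstant fun g => F (M.obj.ρ g m) :=
      (orbit_isLocallyConstant M m).comp F
    refine (integral_congr (orbit_isLocallyConstant N (F m)) hF he μ).trans ?_
    exact integral_comp (orbit_isLocallyConstant M m) F hF μ

/-- The endomorphism of the forgetful functor of smooth modules defined by an endomorphism of
the forgetful functor of contramodules. -/
noncomputable def smoothOfContra (η : End (contraForget.{u, v, w} k G)) : End (smoothForget.{u, v, w} k G) where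
  app N := ModuleCat.ofHom ((η.app (homContra N (ModuleCat.of k N.obj.V))).hom
    (LinearMap.id : N.obj.V →ₗ[k] N.obj.V) : N.obj.V →ₗ[k] N.obj.V)
  naturality M N f := by
    refine ModuleCat.hom_ext ?_
    have h1 := contraEnd_naturality η (homContraMap M (V := ModuleCat.of k M.obj.V)
      (W := ModuleCat.of k N.obj.V) f.hom.hom.toLinearMap) (LinearMap.id : M.obj.V →ₗ[k] M.obj.V)
    have h2 := contraEnd_naturality η (homContraComap f (ModuleCat.of k N.obj.V))
      (LinearMap.id : N.obj.V →ₗ[k] N.obj.V)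
    -- Both composites equal the value of η on f in Hom(M, N), the image of the two identity maps.
    exact h2.symm.trans h1

/-- Any ξ is the image of the identity under the morphism Hom(N, N) → Hom(N, V) of composition with
ξ. -/
theorem contraEnd_homContra (η : End (contraForget.{u, v, w} k G)) (N : SmoothRep.{u, v, w} k G)
    (V : ModuleCat.{w} k) (ξ : N.obj.V →ₗ[k] V) :
    (η.app (homContra N V)).hom ξ = ξ ∘ₗ ((smoothOfContra η).app N).hom :=
  contraEnd_naturality η (homContraMap N (V := ModuleCat.of k N.obj.V) ξ)
    (LinearMap.id : N.obj.V →ₗ[k] N.obj.V)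

theorem smoothOfContra_contraAct (t : equivariantEnd k G) :
    smoothOfContra (contraAct.{u, v, w} t) = smoothAct t := by
  refine NatTrans.ext (funext fun N => ModuleCat.hom_ext ?_)
  exact contraEval_homContra t N (ModuleCat.of k N.obj.V) LinearMap.id

/-- Naturality along t ↦ p·t shows that η acts by t = η(id) in End(k(G)); naturality along the
inclusion into Hom(S', S') identifies this t with the element that defines `smoothOfContra η`. -/
theorem contraAct_smoothOfContra (η : End (contraForget.{u, v, max u v} k G)) :
    contraAct (equivariantOfEnd (smoothOfContra η)) = η := by
  refine NatTrans.ext (funext fun P => ModuleCat.hom_ext (LinearMap.ext fun p => ?_))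
  let t : equivariantEnd k G := (η.app (equivariantContra k G)).hom (equivariantId k G)
  have h1 : (η.app P).hom p = contraEval P t p := by
    have h := contraEnd_naturality η (contraEvalHom P p) (equivariantId k G)
    refine Eq.trans ?_ h
    exact congrArg (η.app P).hom (contraEval_id k G P p).symm
  have h2 : t = equivariantOfEnd (smoothOfContra η) := by
    refine Subtype.ext ?_
    have h := contraEnd_naturality η (equivariantContraIncl k G) (equivariantId k G)
    refine (actMap_rightRegular t).symm.trans (h.symm.trans ?_)
    exact congrArg (η.app _).hom (actMap_rightRegular (equivariantId k G))
  rw [h1, h2]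
  rfl

variable (k G) in
/-- The algebra of endomorphisms of the forgetful functor of contramodules is opposite to the
one of the forgetful functor of smooth modules. -/
noncomputable def contraEndEquiv : End (contraForget.{u, v, max u v} k G) ≃ₐ[k]
    (End (smoothForget.{u, v, max u v} k G))ᵐᵒᵖ :=
  { toFun := fun η => MulOpposite.op (smoothOfContra η)
    invFun := fun θ => contraAct (equivariantOfEnd θ.unop)
    left_inv := contraAct_smoothOfContra
    right_inv := fun θ => congrArg MulOpposite.op
      ((smoothOfContra_contraAct _).trans (smoothAct_equivariantOfEnd θ.unop))
    -- Acting in Hom(N, N) by precomposition reverses the order of products, whence the opposite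
    -- algebra.
    map_mul' := fun η _ => congrArg MulOpposite.op (NatTrans.ext (funext fun N =>
      ModuleCat.hom_ext (contraEnd_homContra η N (ModuleCat.of k N.obj.V) _)))
    map_add' := fun _ _ => rfl
    commutes' := fun _ => rfl }

end ContraEnd

end SmoothContra

theorem mainTheorem10 (k : Type u) (G : Type v) [Field k] [Group G] [TopologicalSpace G]
    [IsTopologicalGroup G] [LocallyCompactSpace G] [TotallyDisconnectedSpace G] [T2Space G] :
    ∃ (α : End (smoothForget.{u, v, max u v} k G) ≃ₐ[k] (heckeT k G)ᵐᵒᵖ)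
      (β : End (contraForget.{u, v, max u v} k G) ≃ₐ[k] heckeT k G),
      (∀ (η : End (smoothForget.{u, v, max u v} k G)) (f : testFunctions k G),
        ((α η).unop.unop.hom.hom f : testFunctions k G) =
          (η.app (rightRegular k G)).hom f) ∧
      (∀ (t : heckeT k G) (N : SmoothRep.{u, v, max u v} k G) (V : ModuleCat.{max u v} k)
        (ξ : N.obj.V →ₗ[k] V),
        ((β.symm t).app (homContra N V)).hom ξ =
          ξ ∘ₗ ((α.symm (MulOpposite.op t)).app N).hom) := by
  refine ⟨(smoothEndEquiv k G).trans (AlgEquiv.opOp k _),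
    (contraEndEquiv k G).trans (AlgEquiv.op (smoothEndEquiv k G)), fun η f => rfl,
    fun t N V ξ => ?_⟩
  let t' := endLeftRegularEquiv t.unop
  refine (contraEval_homContra (equivariantOfEnd (smoothAct t')) N V ξ).trans ?_
  -- The inverse of β passes through endomorphisms of smooth modules; this removes the round trip.
  rw [equivariantOfEnd_smoothAct]
  rfl
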